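/- Let $f(z)=\frac{i}{6}z^3+\frac14\mathrm{Li}_3(e^{-2iz})$, where $\mathrm{Li}_3(w)=\sum_{n\ge1}w^n/n^3$ for $|w|<1$; thus $f$ is holomorphic for $\operatorname{Im}z<0$, and it is continued analytically to a multivalued function on $\mathbb C\setminus\pi\mathbb Z$ with $f'''(z)=\cot z$. For a finite collection $\mathcal A\subset\mathbb C^N$ of non-zero vectors $\alpha$ with multiplicities $c_\alpha\in\mathbb C$ consider the (multivalued) function $$F(x)=\sum_{\alpha\in\mathcal A}c_\alpha f((\alpha,x)),\qquad x\in\mathbb C^N,\quad (\alpha,x)\notin\pi\mathbb Z\ \text{ for all }\alpha\in\mathcal A,$$ where $(x,y)=\sum_i x^iy^i$, and let $F_i$ be the $N\times N$ matrix with entries $(F_i)_{pk}=\partial^3F/\partial x^i\partial x^p\partial x^k$. Let $r,q\in\mathbb C$ with $q\neq0$, and suppose that $r=-2q$ or $r=-4q$. Let $(\mathcal A,c)$ be one of the following configurations, where $e_1,\dots,e_N$ is the standard basis and all choices of signs are taken. 1. $F_4^+$ ($N=4$): $e_i$ ($1\le i\le4$) and $\frac12(e_1\pm e_2\pm e_3\pm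 e_4)$ with multiplicity $r$; $e_i\pm e_j$ ($1\le i<j\le4$) with multiplicity $q$. 2. $(F_4,A_1)_1$ ($N=3$): $e_i$ ($1\le i\le 3$) with multiplicity $r+2q$; $e_i\pm e_j$ ($1\le i<j\le3$) with multiplicity $q$; $\frac12(e_1\pm e_2\pm e_3)$ with multiplicity $2r$. 3. $(F_4,A_1)_2$ ($N=3$): $e_1,e_2$ with multiplicity $r$; $\sqrt2e_3$ with multiplicity $q$; $\frac{\sqrt2}2e_3$ with multiplicity $2r$; $e_1\pm e_2$ with multiplicity $q$; $\frac12(e_1\pm e_2)$ with multiplicity $2r$; $e_1\pm\frac{\sqrt2}2e_3$ and $e_2\pm\frac{\sqrt2}2e_3$ with multiplicity $2q$; $\frac12(e_1\pm e_2\pm\sqrt2e_3)$ with multiplicity $r$. (The second and third configurations are the orthogonal projections of $F_4^+$ to the hyperplanes orthogonal to $e_4$ and to $e_3-e_4$ respectively.) Then $F$ satisfies the WDVV equations: for all functions $A^1,\dots,A^N$, at every point where every $(\alpha,x)\notin\pi\mathbb Z$ and the matrix $B=\sum_{k=1}^NA^kF_k$ is non-degenerate, and for every branch of $F$ there, $$F_iB^{-1}F_j=F_jB^{-1}F_i,\qquad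 i,j=1,\dots,N.$$ Moreover such matrices $B$ exist generically: there are a dense open subset $U\subset\mathbb C^N$, on which $(\alpha,x)\notin\pi\mathbb Z$ for all $\alpha\in\mathcal A$, and holomorphic functions $A^1,\dots,A^N$ on $U$ such that $B$ is non-degenerate at every point of $U$. -/

import Mathlib

open scoped Topology Matrix

noncomputable section

/-- The trilogarithm `Li₃`, given by its power series on the unit disc
(only used for `‖w‖ < 1`). -/
def trilogSeries (w : ℂ) : ℂ := ∑' n : ℕ, w ^ (n + 1) / ((n : ℂ) + 1) ^ 3

/-- The function `f(z) = (i/6) z³ + (1/4) Li₃(e^{-2iz})` on the lower half-plane, where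
`|e^{-2iz}| < 1`. Elsewhere `f` is a multivalued function, see `IsBranchOfTrigF`. -/
def trigF (z : ℂ) : ℂ :=
  (1 / 6) * Complex.I * z ^ 3 + (1 / 4) * trilogSeries (Complex.exp (-2 * Complex.I * z))

/-- The germ of `h` at `b` is an analytic continuation of the germ of `g` at `a` along the
path `γ`: there are germs `G t` at the points `γ t`, locally compatible with each other, which
start with `g` and end with `h`. -/
def IsContinuationAlong (g h : ℂ → ℂ) {a b : ℂ} (γ : Path a b) : Prop :=
  ∃ G : unitInterval → ℂ → ℂ,
    (∀ t, AnalyticAt ℂ (G t) (γ t)) ∧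
    (∀ t, ∀ᶠ s in 𝓝 t, G s =ᶠ[𝓝 (γ s)] G t) ∧
    G 0 =ᶠ[𝓝 a] g ∧ G 1 =ᶠ[𝓝 b] h

/-- Near `z`, the function `h` is a branch of the multivalued function
`f(z) = (i/6) z³ + (1/4) Li₃(e^{-2iz})`, that is, it is obtained from the defining expression on
the lower half-plane by analytic continuation along a path. -/
def IsBranchOfTrigF (h : ℂ → ℂ) (z : ℂ) : Prop :=
  ∃ (a : ℂ) (γ : Path a z), a.im < 0 ∧ IsContinuationAlong trigF h γ

/-- A finite configuration of `m` vectors in `ℂ^N`, each with its multiplicity. -/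
abbrev VectorConfiguration (N m : ℕ) : Type := Fin m → (Fin N → ℂ) × ℂ

/-- The complement of the hyperplanes `(α, x) ∈ πℤ`, on which `F` is a (multivalued) analytic
function. -/
def regularLocus {N m : ℕ} (C : VectorConfiguration N m) : Set (Fin N → ℂ) :=
  {x | ∀ k, Complex.sin ((C k).1 ⬝ᵥ x) ≠ 0}

/-- Near `x`, the function `F` is a branch of the prepotential
`∑_α c_α f((α, x))`, where `(·,·)` is the standard bilinear product on `ℂ^N`. -/
def IsPrepotentialAt {N m : ℕ} (C : VectorConfiguration N m) (F : (Fin N → ℂ) → ℂ)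
    (x : Fin N → ℂ) : Prop :=
  ∃ h : Fin m → ℂ → ℂ,
    (∀ k, IsBranchOfTrigF (h k) ((C k).1 ⬝ᵥ x)) ∧
    F =ᶠ[𝓝 x] fun y => ∑ k, (C k).2 * h k ((C k).1 ⬝ᵥ y)

/-- The partial derivative `∂F/∂x^i`. -/
def partialDeriv {N : ℕ} (i : Fin N) (F : (Fin N → ℂ) → ℂ) (x : Fin N → ℂ) : ℂ :=
  fderiv ℂ F x (Pi.single i 1)

/-- The matrix `F_i` of third order derivatives, `(F_i)_{pq} = ∂³F/∂x^i∂x^p∂x^q`. -/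
def thirdDerivMatrix {N : ℕ} (F : (Fin N → ℂ) → ℂ) (i : Fin N) (x : Fin N → ℂ) :
    Matrix (Fin N) (Fin N) ℂ :=
  Matrix.of fun p q => partialDeriv i (partialDeriv p (partialDeriv q F)) x

/-- The matrix `B = ∑_k A^k F_k` for functions `A^k`. -/
def metricMatrix {N : ℕ} (F : (Fin N → ℂ) → ℂ) (A : Fin N → (Fin N → ℂ) → ℂ)
    (x : Fin N → ℂ) : Matrix (Fin N) (Fin N) ℂ :=
  ∑ k, A k x • thirdDerivMatrix F k x

/-- The prepotential of the configuration `C` satisfies the WDVV equations: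

* at every point `x`, for every branch `F` of the prepotential at `x` and for all functions `A^k`
  such that `B = ∑_k A^k F_k` is non-degenerate at `x`,
  the equations `F_i B⁻¹ F_j = F_j B⁻¹ F_i` hold at `x` for all `i, j`;
* generically such non-degenerate `B` exist: on some dense open subset `U` of the domain of the
  prepotential there are holomorphic functions `A^k` such that `B` is non-degenerate on `U`. -/
def PrepotentialSatisfiesWDVV {N m : ℕ} (C : VectorConfiguration N m) : Prop :=
  (∀ (x : Fin N → ℂ) (F : (Fin N → ℂ) → ℂ), IsPrepotentialAt C F x →
    ∀ A : Fin N → (Fin N → ℂ) → ℂ, (metricMatrix F A x).det ≠ 0 →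
      ∀ i j : Fin N,
        thirdDerivMatrix F i x * (metricMatrix F A x)⁻¹ * thirdDerivMatrix F j x =
          thirdDerivMatrix F j x * (metricMatrix F A x)⁻¹ * thirdDerivMatrix F i x) ∧
  ∃ U : Set (Fin N → ℂ), IsOpen U ∧ Dense U ∧ U ⊆ regularLocus C ∧
    ∃ A : Fin N → (Fin N → ℂ) → ℂ, (∀ k, AnalyticOnNhd ℂ (A k) U) ∧
      ∀ x ∈ U, ∀ F : (Fin N → ℂ) → ℂ, IsPrepotentialAt C F x → (metricMatrix F A x).det ≠ 0

/-- The positive half `F₄⁺` of the root system `F₄`; short roots have multiplicity `r`, long roots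
have multiplicity `q`. -/
def F4Plus (r q : ℂ) : VectorConfiguration 4 24 := ![
  (![1, 0, 0, 0], r), (![0, 1, 0, 0], r), (![0, 0, 1, 0], r), (![0, 0, 0, 1], r),
  (![1, 1, 0, 0], q), (![1, -1, 0, 0], q), (![1, 0, 1, 0], q), (![1, 0, -1, 0], q),
  (![1, 0, 0, 1], q), (![1, 0, 0, -1], q), (![0, 1, 1, 0], q), (![0, 1, -1, 0], q),
  (![0, 1, 0, 1], q), (![0, 1, 0, -1], q), (![0, 0, 1, 1], q), (![0, 0, 1, -1], q),
  (![1 / 2, 1 / 2, 1 / 2, 1 / 2], r), (![1 / 2, 1 / 2, 1 / 2, -1 / 2], r),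
  (![1 / 2, 1 / 2, -1 / 2, 1 / 2], r), (![1 / 2, 1 / 2, -1 / 2, -1 / 2], r),
  (![1 / 2, -1 / 2, 1 / 2, 1 / 2], r), (![1 / 2, -1 / 2, 1 / 2, -1 / 2], r),
  (![1 / 2, -1 / 2, -1 / 2, 1 / 2], r), (![1 / 2, -1 / 2, -1 / 2, -1 / 2], r)]

/-- The projection `(F₄, A₁)₁` of `F₄⁺` to the hyperplane orthogonal to the short simple root
`e₄`. -/
def F4A1One (r q : ℂ) : VectorConfiguration 3 13 := ![
  (![1, 0, 0], r + 2 * q), (![0, 1, 0], r + 2 * q), (![0, 0, 1], r + 2 * q),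
  (![1, 1, 0], q), (![1, -1, 0], q), (![1, 0, 1], q), (![1, 0, -1], q),
  (![0, 1, 1], q), (![0, 1, -1], q),
  (![1 / 2, 1 / 2, 1 / 2], 2 * r), (![1 / 2, 1 / 2, -1 / 2], 2 * r),
  (![1 / 2, -1 / 2, 1 / 2], 2 * r), (![1 / 2, -1 / 2, -1 / 2], 2 * r)]

/-- The number `√2` as a complex number. -/
def sqrtTwo : ℂ := (Real.sqrt 2 : ℝ)

/-- The projection `(F₄, A₁)₂` of `F₄⁺` to the hyperplane orthogonal to the long simple root
`e₃ - e₄`, in the orthonormal basis `e₁, e₂, (e₃ + e₄)/√2` of this hyperplane. -/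
def F4A1Two (r q : ℂ) : VectorConfiguration 3 16 := ![
  (![1, 0, 0], r), (![0, 1, 0], r),
  (![0, 0, sqrtTwo], q), (![0, 0, sqrtTwo / 2], 2 * r),
  (![1, 1, 0], q), (![1, -1, 0], q),
  (![1 / 2, 1 / 2, 0], 2 * r), (![1 / 2, -1 / 2, 0], 2 * r),
  (![1, 0, sqrtTwo / 2], 2 * q), (![1, 0, -sqrtTwo / 2], 2 * q),
  (![0, 1, sqrtTwo / 2], 2 * q), (![0, 1, -sqrtTwo / 2], 2 * q),
  (![1 / 2, 1 / 2, sqrtTwo / 2], r), (![1 / 2, 1 / 2, -sqrtTwo / 2], r),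
  (![1 / 2, -1 / 2, sqrtTwo / 2], r), (![1 / 2, -1 / 2, -sqrtTwo / 2], r)]

end

/-! On the lower half-plane, differentiating the trilogarithm series three times gives f''' = cot,
and this identity survives analytic continuation. So for every branch of F, the matrix F_i is the
single-valued sum of c_α cot((α,x)) α_i α⊗α over the configuration
(`IsPrepotentialAt.thirdDerivMatrix_eq`).

The core fact is that the matrices F_i commute pairwise. Then each F_i commutes with B, hence with
B⁻¹, and the WDVV equations follow (`mul_inv_mul_comm_of_commute`). With X_α = cot((α,x)), the
commutator [F_i, F_j] is a sum over pairs of vectors of c_α c_β (α,β) X_α X_β times products of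
components of α∧β, so orthogonal and parallel pairs drop out. The remaining products are removed by
cot u cot v = cot(u+v)(cot u + cot v) + 1, applied to relations α+β=γ inside the configuration. The
constants 1 add up to zero or to a multiple of r²+6rq+8q² = (r+2q)(r+4q); this is the origin of the
two admissible ratios. The lemmas `F4Plus_commute`, `F4A1One_commute` and `F4A1Two_commute` carry
this out.

For generic non-degeneracy, let x = -itv with (α,v) > 0 for all α and t → ∞. All cotangents tend to
i, and for a suitable constant vector a the matrix ∑ a_k F_k tends to a non-zero scalar matrix.
After clearing denominators its determinant is an entire function that is not identically zero, so
it is non-zero on a dense open set (`prepotentialSatisfiesWDVV_of_commute`). -/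

open Set Filter

/-! ### The third derivative of f on the lower half-plane -/

/-- The polylogarithm series `∑ wⁿ / nᵏ`. -/
noncomputable def polylogSeries (k : ℕ) (w : ℂ) : ℂ := ∑' n : ℕ, w ^ (n + 1) / ((n : ℂ) + 1) ^ k

lemma norm_polylogSeries_term_le (k n : ℕ) {w : ℂ} {ρ : ℝ} (h : ‖w‖ ≤ ρ) :
    ‖w ^ (n + 1) / ((n : ℂ) + 1) ^ k‖ ≤ ρ ^ (n + 1) := by
  have h1 : (1 : ℝ) ≤ ‖((n : ℂ) + 1) ^ k‖ := by
    rw [norm_pow]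
    apply one_le_pow₀
    have : ((n : ℂ) + 1) = ((n + 1 : ℕ) : ℂ) := by push_cast; rfl
    rw [this, Complex.norm_natCast]
    push_cast
    linarith [(Nat.cast_nonneg n : (0 : ℝ) ≤ n)]
  rw [norm_div, norm_pow]
  exact (div_le_self (by positivity) h1).trans (pow_le_pow_left₀ (norm_nonneg _) h _)

lemma summable_pow_succ {ρ : ℝ} (h0 : 0 ≤ ρ) (h1 : ρ < 1) : Summable fun n : ℕ => ρ ^ (n + 1) :=
  (summable_nat_add_iff 1).2 (summable_geometric_of_lt_one h0 h1)

/-- Termwise differentiation on a disc of radius ρ < 1, dominated by a geometric series. Multiplying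
the derivative by w, rather than dividing the lower polylogarithm by w, keeps w = 0 unexceptional.
-/
lemma hasDerivAt_polylogSeries (k : ℕ) {w : ℂ} (hw : ‖w‖ < 1) :
    ∃ d, HasDerivAt (polylogSeries (k + 1)) d w ∧ w * d = polylogSeries k w := by
  obtain ⟨ρ, hρ, hρ1⟩ := exists_between hw
  have h0 : 0 ≤ ρ := (norm_nonneg w).trans hρ.le
  have hU : IsOpen (Metric.ball (0 : ℂ) ρ) := Metric.isOpen_ball
  have hwU : w ∈ Metric.ball (0 : ℂ) ρ := by simpa using hρ
  have hd : ∀ n : ℕ, DifferentiableOn ℂ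
      (fun w : ℂ => w ^ (n + 1) / ((n : ℂ) + 1) ^ (k + 1)) (Metric.ball 0 ρ) := by
    intro n; fun_prop
  have hb : ∀ (n : ℕ) (w : ℂ), w ∈ Metric.ball (0 : ℂ) ρ →
      ‖w ^ (n + 1) / ((n : ℂ) + 1) ^ (k + 1)‖ ≤ ρ ^ (n + 1) := fun n w hw =>
    norm_polylogSeries_term_le _ _ (by simpa using (Metric.mem_ball.1 hw).le)
  have hs := summable_pow_succ h0 hρ1
  refine ⟨_, ((Complex.differentiableOn_tsum_of_summable_norm hs hd hU hb).differentiableAt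
    (hU.mem_nhds hwU)).hasDerivAt, ?_⟩
  have := (Complex.hasSum_deriv_of_summable_norm hs hd hU hb hwU).mul_left w
  refine (this.tsum_eq.symm.trans ?_)
  refine tsum_congr fun n => ?_
  have hn : ((n : ℂ) + 1) ≠ 0 := Nat.cast_add_one_ne_zero n
  rw [deriv_div_const, deriv_pow_field]
  push_cast
  field_simp
  ring

lemma polylogSeries_zero {w : ℂ} (hw : ‖w‖ < 1) : polylogSeries 0 w = w / (1 - w) := by
  have : ∀ n : ℕ, w ^ (n + 1) / ((n : ℂ) + 1) ^ 0 = w * w ^ n := fun n => by ring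
  simp only [polylogSeries, this, tsum_mul_left, tsum_geometric_of_norm_lt_one hw, div_eq_mul_inv]

lemma norm_exp_neg_two_I_mul_lt_one {z : ℂ} (hz : z.im < 0) :
    ‖Complex.exp (-2 * Complex.I * z)‖ < 1 := by
  rw [Complex.norm_exp, Real.exp_lt_one_iff]
  simp
  linarith

lemma hasDerivAt_polylogSeries_exp (k : ℕ) {z : ℂ} (hz : z.im < 0) :
    HasDerivAt (fun z => polylogSeries (k + 1) (Complex.exp (-2 * Complex.I * z)))
      (-2 * Complex.I * polylogSeries k (Complex.exp (-2 * Complex.I * z))) z := by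
  obtain ⟨d, hd, hd'⟩ := hasDerivAt_polylogSeries k (norm_exp_neg_two_I_mul_lt_one hz)
  have he : HasDerivAt (fun z => Complex.exp (-2 * Complex.I * z))
      (Complex.exp (-2 * Complex.I * z) * (-2 * Complex.I)) z := by
    simpa using ((hasDerivAt_id z).const_mul (-2 * Complex.I)).cexp
  refine (hd.comp z he).congr_deriv ?_
  rw [← hd']
  ring

lemma isOpen_im_neg : IsOpen {z : ℂ | z.im < 0} := isOpen_lt Complex.continuous_im continuous_const

lemma hasDerivAt_trigF {z : ℂ} (hz : z.im < 0) :
    HasDerivAt trigF ((1 / 2) * Complex.I * z ^ 2 +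
      (1 / 4) * (-2 * Complex.I * polylogSeries 2 (Complex.exp (-2 * Complex.I * z)))) z := by
  refine ((((hasDerivAt_id z).pow 3).const_mul ((1 / 6) * Complex.I)).add
    ((hasDerivAt_polylogSeries_exp 2 hz).const_mul (1 / 4))).congr_deriv ?_
  simp only [id]
  push_cast
  ring

lemma sin_mul_iteratedDeriv_trigF {z : ℂ} (hz : z.im < 0) :
    Complex.sin z * deriv (deriv (deriv trigF)) z = Complex.cos z := by
  have e1 : deriv trigF =ᶠ[𝓝 z] fun z => (1 / 2) * Complex.I * z ^ 2 +
      (1 / 4) * (-2 * Complex.I * polylogSeries 2 (Complex.exp (-2 * Complex.I * z))) := by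
    filter_upwards [isOpen_im_neg.mem_nhds hz] with y hy using (hasDerivAt_trigF hy).deriv
  have e2 : deriv (deriv trigF) =ᶠ[𝓝 z] fun y => Complex.I * y +
      (1 / 4) * (-2 * Complex.I * (-2 * Complex.I *
        polylogSeries 1 (Complex.exp (-2 * Complex.I * y)))) := by
    filter_upwards [e1.eventuallyEq_nhds, isOpen_im_neg.mem_nhds hz] with y h1 hy
    rw [h1.deriv_eq]
    refine HasDerivAt.deriv (((((hasDerivAt_id y).pow 2).const_mul ((1 / 2) * Complex.I)).add
      (((hasDerivAt_polylogSeries_exp 1 hy).const_mul (-2 * Complex.I)).const_mul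
        (1 / 4))).congr_deriv ?_)
    simp only [id]
    push_cast
    ring
  have e3 := (((hasDerivAt_id z).const_mul Complex.I).add
      ((((hasDerivAt_polylogSeries_exp 0 hz).const_mul (-2 * Complex.I)).const_mul
        (-2 * Complex.I)).const_mul (1 / 4))).deriv
  have hw := norm_exp_neg_two_I_mul_lt_one hz
  rw [e2.deriv_eq]
  refine (congrArg (Complex.sin z * ·) e3).trans ?_
  have hne : 1 - Complex.exp (-2 * Complex.I * z) ≠ 0 := by
    intro h
    rw [sub_eq_zero] at h
    rw [← h] at hw
    simp at hw
  rw [polylogSeries_zero hw]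
  -- With u = e^{-iz} and v = e^{iz}, the third derivative is i(1+u²)/(1-u²), and uv = 1 turns it
  -- into the cotangent.
  have hexp : Complex.exp (-2 * Complex.I * z) = Complex.exp (-z * Complex.I) ^ 2 := by
    rw [← Complex.exp_nat_mul]; congr 1; push_cast; ring
  have hinv : Complex.exp (z * Complex.I) * Complex.exp (-z * Complex.I) = 1 := by
    rw [← Complex.exp_add]; simp
  rw [hexp] at hne ⊢
  rw [neg_mul] at hne hinv
  simp only [Complex.sin, Complex.cos, neg_mul]
  generalize Complex.exp (-(z * Complex.I)) = u at *
  generalize Complex.exp (z * Complex.I) = v at *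
  field_simp
  rw [Complex.I_sq]
  field_simp
  linear_combination 8 * u * hinv

/-! ### Permanence of the differential equation under analytic continuation -/

/-- The differential equation `sin · h''' = cos` near `z`. -/
def IsCotPrimitiveNear (h : ℂ → ℂ) (z : ℂ) : Prop :=
  ∀ᶠ y in 𝓝 z, Complex.sin y * deriv (deriv (deriv h)) y = Complex.cos y

lemma IsCotPrimitiveNear.congr {g h : ℂ → ℂ} {z : ℂ} (hg : IsCotPrimitiveNear g z)
    (hgh : g =ᶠ[𝓝 z] h) : IsCotPrimitiveNear h z := by
  filter_upwards [hg, hgh.deriv.deriv.deriv] with y h1 h2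
  rwa [← h2]

lemma isCotPrimitiveNear_trigF {z : ℂ} (hz : z.im < 0) : IsCotPrimitiveNear trigF z := by
  filter_upwards [isOpen_im_neg.mem_nhds hz] with y hy using sin_mul_iteratedDeriv_trigF hy

/-- By the identity theorem, the differential equation holds near every point close to `z`
or near none of them. -/
lemma eventually_isCotPrimitiveNear_iff {h : ℂ → ℂ} {z : ℂ} (hh : AnalyticAt ℂ h z) :
    ∀ᶠ y in 𝓝 z, (IsCotPrimitiveNear h y ↔ IsCotPrimitiveNear h z) := by
  have han : ∀ᶠ y in 𝓝 z, AnalyticAt ℂ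
      (fun y => Complex.sin y * deriv (deriv (deriv h)) y) y := by
    filter_upwards [hh.eventually_analyticAt] with y hy
    exact (Complex.analyticAt_sin).mul hy.deriv.deriv.deriv
  obtain ⟨ε, hε, hb⟩ := Metric.eventually_nhds_iff_ball.1 han
  have hpc : IsPreconnected (Metric.ball z ε) := (convex_ball z ε).isPreconnected
  have key : ∀ y ∈ Metric.ball z ε, IsCotPrimitiveNear h y →
      ∀ y' ∈ Metric.ball z ε, IsCotPrimitiveNear h y' := by
    intro y hy hy1 y' hy'
    have := AnalyticOnNhd.eqOn_of_preconnected_of_eventuallyEq hb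
      (fun w _ => Complex.analyticAt_cos) hpc hy hy1
    filter_upwards [Metric.isOpen_ball.mem_nhds hy'] with w hw using this hw
  filter_upwards [Metric.ball_mem_nhds z hε] with y hy
  exact ⟨fun h1 => key y hy h1 z (Metric.mem_ball_self hε),
    fun h1 => key z (Metric.mem_ball_self hε) h1 y hy⟩

/-- The parameters along the path at which the germ satisfies the equation form a clopen set, by the
local dichotomy; it contains 0, so it is the whole interval. -/
lemma IsBranchOfTrigF.analyticAt_and_isCotPrimitiveNear {h : ℂ → ℂ} {z : ℂ}
    (hh : IsBranchOfTrigF h z) : AnalyticAt ℂ h z ∧ IsCotPrimitiveNear h z := by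
  obtain ⟨a, γ, ha, G, hG, hc, h0, h1⟩ := hh
  set S : Set unitInterval := {t | IsCotPrimitiveNear (G t) (γ t)}
  have hloc : ∀ t, ∀ᶠ s in 𝓝 t, (s ∈ S ↔ t ∈ S) := by
    intro t
    filter_upwards [hc t, γ.continuous.continuousAt.eventually
      (eventually_isCotPrimitiveNear_iff (hG t))] with s hs1 hs2
    exact ⟨fun h => hs2.1 (h.congr hs1), fun h => (hs2.2 h).congr hs1.symm⟩
  have hclopen : IsClopen S := by
    refine ⟨isOpen_compl_iff.1 (isOpen_iff_eventually.2 fun t ht => ?_),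
      isOpen_iff_eventually.2 fun t ht => ?_⟩
    · filter_upwards [hloc t] with s hs using fun h => ht (hs.1 h)
    · filter_upwards [hloc t] with s hs using hs.2 ht
  have h0S : (0 : unitInterval) ∈ S := by
    have : IsCotPrimitiveNear (G 0) a := (isCotPrimitiveNear_trigF ha).congr h0.symm
    simpa [S] using this
  have h1S : (1 : unitInterval) ∈ S := by
    rw [hclopen.eq_univ ⟨0, h0S⟩]; trivial
  have hG1 := hG 1
  simp only [S, mem_ofPred_eq] at h1S
  rw [γ.target] at h1S hG1
  exact ⟨hG1.congr h1, h1S.congr h1⟩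

/-- A branch is analytic at its end point, so a zero of the sine would force the cosine to vanish
there too. Thus avoidance of πℤ need not be built into the definition of continuation. -/
lemma IsBranchOfTrigF.sin_ne_zero {h : ℂ → ℂ} {z : ℂ} (hh : IsBranchOfTrigF h z) :
    Complex.sin z ≠ 0 := by
  intro h0
  have h1 := hh.analyticAt_and_isCotPrimitiveNear.2.self_of_nhds
  have h2 := Complex.sin_sq_add_cos_sq z
  rw [← h1, h0] at h2
  simp at h2

lemma IsBranchOfTrigF.iteratedDeriv_eq {h : ℂ → ℂ} {z : ℂ} (hh : IsBranchOfTrigF h z) :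
    deriv (deriv (deriv h)) z = Complex.cot z := by
  rw [Complex.cot, eq_div_iff hh.sin_ne_zero, mul_comm]
  exact hh.analyticAt_and_isCotPrimitiveNear.2.self_of_nhds

/-! ### The third derivatives of the prepotential -/

/-- Chain rule for linear arguments. The result is again a weighted sum of functions of (α,x), valid
on a neighbourhood, so the lemma can be applied to its own output three times. -/
lemma partialDeriv_sum_comp_dotProduct {N m : ℕ} (α : Fin m → Fin N → ℂ) (c : Fin m → ℂ)
    (h : Fin m → ℂ → ℂ) {F : (Fin N → ℂ) → ℂ} {x : Fin N → ℂ}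
    (hh : ∀ k, AnalyticAt ℂ (h k) (α k ⬝ᵥ x))
    (hF : F =ᶠ[𝓝 x] fun y => ∑ k, c k * h k (α k ⬝ᵥ y)) (i : Fin N) :
    partialDeriv i F =ᶠ[𝓝 x] fun y => ∑ k, (c k * α k i) * deriv (h k) (α k ⬝ᵥ y) := by
  have hcont : ∀ k, Continuous fun y : Fin N → ℂ => α k ⬝ᵥ y := fun k => by
    simp only [dotProduct]; fun_prop
  have han : ∀ᶠ y in 𝓝 x, ∀ k, AnalyticAt ℂ (h k) (α k ⬝ᵥ y) :=
    eventually_all.2 fun k => (hcont k).continuousAt.eventually (hh k).eventually_analyticAt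
  filter_upwards [hF.eventuallyEq_nhds, han] with y hy hy'
  have hlin : ∀ k, HasFDerivAt (fun y : Fin N → ℂ => α k ⬝ᵥ y)
      (∑ l, α k l • ContinuousLinearMap.proj (R := ℂ) (φ := fun _ : Fin N => ℂ) l) y := by
    intro k
    simp only [dotProduct]
    exact HasFDerivAt.fun_sum fun l _ => (hasFDerivAt_apply l y).const_mul (α k l)
  have hd : HasFDerivAt (fun y => ∑ k, c k * h k (α k ⬝ᵥ y)) _ y :=
    HasFDerivAt.fun_sum fun k _ =>
      ((hy' k).differentiableAt.hasDerivAt.comp_hasFDerivAt y (hlin k)).const_mul (c k)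
  rw [partialDeriv, hy.fderiv_eq, hd.fderiv]
  simp only [_root_.sum_apply, _root_.smul_apply,
    ContinuousLinearMap.proj_apply, smul_eq_mul]
  refine Finset.sum_congr rfl fun k _ => ?_
  rw [Finset.sum_eq_single i]
  · simp; ring
  · intro l _ hl; simp [hl]
  · simp

/-- The matrix `∑_α c_α α_i cot((α, x)) α ⊗ α`. -/
noncomputable def cotMatrix {N m : ℕ} (C : VectorConfiguration N m) (i : Fin N) (x : Fin N → ℂ) :
    Matrix (Fin N) (Fin N) ℂ :=
  Matrix.of fun p q => ∑ k, (C k).2 * Complex.cot ((C k).1 ⬝ᵥ x) *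
    ((C k).1 i * (C k).1 p * (C k).1 q)

lemma IsPrepotentialAt.mem_regularLocus {N m : ℕ} {C : VectorConfiguration N m}
    {F : (Fin N → ℂ) → ℂ} {x : Fin N → ℂ} (hF : IsPrepotentialAt C F x) :
    x ∈ regularLocus C := by
  obtain ⟨h, hh, -⟩ := hF
  exact fun k => (hh k).sin_ne_zero

lemma IsPrepotentialAt.thirdDerivMatrix_eq {N m : ℕ} {C : VectorConfiguration N m}
    {F : (Fin N → ℂ) → ℂ} {x : Fin N → ℂ} (hF : IsPrepotentialAt C F x) (i : Fin N) :
    thirdDerivMatrix F i x = cotMatrix C i x := by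
  obtain ⟨h, hh, hF⟩ := hF
  have han := fun k => (hh k).analyticAt_and_isCotPrimitiveNear.1
  ext p q
  have := (partialDeriv_sum_comp_dotProduct _ _ _ (fun k => (han k).deriv.deriv)
    (partialDeriv_sum_comp_dotProduct _ _ _ (fun k => (han k).deriv)
      (partialDeriv_sum_comp_dotProduct _ _ _ han hF q) p) i).self_of_nhds
  simp only [thirdDerivMatrix, cotMatrix, Matrix.of_apply]
  rw [this]
  refine Finset.sum_congr rfl fun k _ => ?_
  rw [(hh k).iteratedDeriv_eq]
  ring

/-! ### From commuting matrices to WDVV, and generic non-degeneracy -/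

/-- B is a linear combination of commuting matrices, so every M_l commutes with B and hence with
B⁻¹; both sides become B⁻¹ times a product of two commuting factors. -/
lemma mul_inv_mul_comm_of_commute {n ι : Type*} [Fintype n] [DecidableEq n] [Fintype ι]
    (M : ι → Matrix n n ℂ) (hM : ∀ i j, Commute (M i) (M j)) (a : ι → ℂ)
    (hdet : (∑ k, a k • M k).det ≠ 0) (i j : ι) :
    M i * (∑ k, a k • M k)⁻¹ * M j = M j * (∑ k, a k • M k)⁻¹ * M i := by
  set B := ∑ k, a k • M k with hB
  have hBu : IsUnit B.det := isUnit_iff_ne_zero.2 hdet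
  have hc : ∀ l, M l * B⁻¹ = B⁻¹ * M l := by
    intro l
    have h : M l * B = B * M l :=
      (Commute.sum_right _ _ _ fun k _ => (hM l k).smul_right (a k)).eq
    calc M l * B⁻¹ = B⁻¹ * B * M l * B⁻¹ := by rw [Matrix.nonsing_inv_mul _ hBu, one_mul]
      _ = B⁻¹ * (M l * B) * B⁻¹ := by rw [h]; simp only [mul_assoc]
      _ = B⁻¹ * M l := by
        rw [mul_assoc, mul_assoc, Matrix.mul_nonsing_inv _ hBu, mul_one]
  rw [hc, hc, mul_assoc, mul_assoc, (hM i j).eq]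

lemma metricMatrix_eq {N m : ℕ} {C : VectorConfiguration N m} {F : (Fin N → ℂ) → ℂ}
    {x : Fin N → ℂ} (hF : IsPrepotentialAt C F x) (A : Fin N → (Fin N → ℂ) → ℂ) :
    metricMatrix F A x = ∑ k, A k x • cotMatrix C k x := by
  simp only [metricMatrix, hF.thirdDerivMatrix_eq]

lemma sum_smul_cotMatrix_apply {N m : ℕ} (C : VectorConfiguration N m) (a x : Fin N → ℂ)
    (p q : Fin N) :
    (∑ i, a i • cotMatrix C i x) p q = ∑ k, Complex.cot ((C k).1 ⬝ᵥ x) *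
      ((C k).2 * ((C k).1 ⬝ᵥ a) * (C k).1 p * (C k).1 q) := by
  simp only [Matrix.sum_apply, Matrix.smul_apply, cotMatrix, Matrix.of_apply, smul_eq_mul,
    dotProduct, Finset.mul_sum, Finset.sum_mul]
  rw [Finset.sum_comm]
  exact Finset.sum_congr rfl fun k _ => Finset.sum_congr rfl fun i _ => by ring

/-- The product of all `sin (α, x)`. -/
noncomputable def sinProd {N m : ℕ} (C : VectorConfiguration N m) (x : Fin N → ℂ) : ℂ :=
  ∏ k, Complex.sin ((C k).1 ⬝ᵥ x)

/-- The matrix `sinProd C x • ∑ i, a i • cotMatrix C i x`, with the denominators cleared. -/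
noncomputable def clearedMatrix {N m : ℕ} (C : VectorConfiguration N m) (a x : Fin N → ℂ) :
    Matrix (Fin N) (Fin N) ℂ :=
  Matrix.of fun p q => ∑ k, (Complex.cos ((C k).1 ⬝ᵥ x) *
    ∏ l ∈ Finset.univ.erase k, Complex.sin ((C l).1 ⬝ᵥ x)) *
      ((C k).2 * ((C k).1 ⬝ᵥ a) * (C k).1 p * (C k).1 q)

lemma sinProd_ne_zero_iff {N m : ℕ} {C : VectorConfiguration N m} {x : Fin N → ℂ} :
    sinProd C x ≠ 0 ↔ x ∈ regularLocus C := by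
  simp [sinProd, regularLocus, Finset.prod_ne_zero_iff]

lemma sinProd_smul_sum_smul_cotMatrix {N m : ℕ} {C : VectorConfiguration N m} (a : Fin N → ℂ)
    {x : Fin N → ℂ} (hx : x ∈ regularLocus C) :
    sinProd C x • ∑ i, a i • cotMatrix C i x = clearedMatrix C a x := by
  ext p q
  rw [Matrix.smul_apply, sum_smul_cotMatrix_apply, smul_eq_mul, Finset.mul_sum]
  simp only [clearedMatrix, Matrix.of_apply]
  refine Finset.sum_congr rfl fun k _ => ?_
  rw [← mul_assoc, sinProd, ← Finset.mul_prod_erase _ _ (Finset.mem_univ k), Complex.cot]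
  have := hx k
  field_simp

lemma analyticAt_dotProduct {N : ℕ} (v x : Fin N → ℂ) :
    AnalyticAt ℂ (fun y : Fin N → ℂ => v ⬝ᵥ y) x := by
  simp only [dotProduct]
  exact Finset.analyticAt_fun_sum _ fun i _ => analyticAt_const.mul
    ((ContinuousLinearMap.proj (R := ℂ) (φ := fun _ : Fin N => ℂ) i).analyticAt x)

lemma analyticAt_sinProd {N m : ℕ} (C : VectorConfiguration N m) (x : Fin N → ℂ) :
    AnalyticAt ℂ (sinProd C) x :=
  Finset.analyticAt_fun_prod _ fun _ _ =>
    Complex.analyticAt_sin.comp (analyticAt_dotProduct _ x)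

lemma analyticAt_det_clearedMatrix {N m : ℕ} (C : VectorConfiguration N m) (a x : Fin N → ℂ) :
    AnalyticAt ℂ (fun y => (clearedMatrix C a y).det) x := by
  simp only [Matrix.det_apply', clearedMatrix, Matrix.of_apply]
  refine Finset.analyticAt_fun_sum _ fun σ _ => analyticAt_const.mul
    (Finset.analyticAt_fun_prod _ fun i _ => Finset.analyticAt_fun_sum _ fun k _ =>
      AnalyticAt.mul (AnalyticAt.mul ?_ ?_) analyticAt_const)
  · exact Complex.analyticAt_cos.comp (analyticAt_dotProduct _ x)
  · exact Finset.analyticAt_fun_prod _ fun l _ =>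
      Complex.analyticAt_sin.comp (analyticAt_dotProduct _ x)

/-- If the non-vanishing set missed a neighbourhood of some point, the identity theorem on the
connected space E would make f vanish everywhere. -/
lemma dense_ne_zero_of_analyticOnNhd {E : Type*} [NormedAddCommGroup E] [NormedSpace ℂ E]
    {f : E → ℂ} (hf : ∀ x, AnalyticAt ℂ f x) {x₀ : E} (h : f x₀ ≠ 0) :
    Dense {x | f x ≠ 0} := by
  intro x
  by_contra hx
  have h0 : f =ᶠ[𝓝 x] 0 := by
    filter_upwards [isClosed_closure.isOpen_compl.mem_nhds hx] with y hy
    by_contra hy0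
    exact hy (subset_closure hy0)
  exact h (AnalyticOnNhd.eqOn_zero_of_preconnected_of_eventuallyEq_zero (U := univ)
    (fun y _ => hf y) isPreconnected_univ (mem_univ x) h0 (mem_univ x₀))

/-- Written in u = e^{-y}, the cotangent becomes a rational function continuous at u = 0, from which
the limit as y → ∞ is read off. -/
lemma cot_neg_I_mul_ofReal {y : ℝ} (hy : 0 < y) :
    Complex.sin (-Complex.I * y) ≠ 0 ∧
    Complex.cot (-Complex.I * y) =
      Complex.I * (1 + Real.exp (-y) ^ 2 : ℝ) / (1 - Real.exp (-y) ^ 2 : ℝ) := by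
  have hlt : Real.exp (-y) < 1 := Real.exp_lt_one_iff.2 (by linarith)
  have hne : (1 - Real.exp (-y) ^ 2 : ℝ) ≠ 0 := by
    have := Real.exp_pos (-y); nlinarith
  have hne' : ((1 : ℂ) - Complex.exp (-(y : ℂ)) ^ 2) ≠ 0 := by
    exact_mod_cast hne
  have hinv : Complex.exp (y : ℂ) * Complex.exp (-(y : ℂ)) = 1 := by
    rw [← Complex.exp_add]; simp
  have e1 : -(-Complex.I * (y : ℂ)) * Complex.I = -y := by linear_combination y * Complex.I_sq
  have e2 : -Complex.I * (y : ℂ) * Complex.I = y := by linear_combination -y * Complex.I_sq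
  have hsin : Complex.sin (-Complex.I * y) ≠ 0 := by
    rw [Complex.sin, e1, e2]
    intro h
    apply hne'
    linear_combination (2 * Complex.I * Complex.exp (-(y : ℂ))) * h - hinv
      - Complex.exp (-(y : ℂ)) * (Complex.exp (-(y : ℂ)) - Complex.exp (y : ℂ)) * Complex.I_sq
  refine ⟨hsin, ?_⟩
  push_cast
  rw [Complex.cot, div_eq_div_iff hsin hne', Complex.sin, Complex.cos, e1, e2]
  generalize Complex.exp (-(y : ℂ)) = u at *
  generalize Complex.exp (y : ℂ) = v at *
  linear_combination (-u) * hinv - (1 + u ^ 2) * (u - v) / 2 * Complex.I_sq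

lemma tendsto_cot_neg_I_mul {s : ℝ} (hs : 0 < s) :
    Tendsto (fun t : ℝ => Complex.cot (-Complex.I * (t * s : ℝ))) atTop (𝓝 Complex.I) := by
  have h1 : Tendsto (fun t : ℝ => Real.exp (-(t * s))) atTop (𝓝 0) :=
    Real.tendsto_exp_neg_atTop_nhds_zero.comp (tendsto_id.atTop_mul_const hs)
  have hc : ContinuousAt (fun u : ℝ => Complex.I * (1 + u ^ 2 : ℝ) / (1 - u ^ 2 : ℝ)) 0 := by
    refine ContinuousAt.div ?_ ?_ (by simp)
    · fun_prop
    · fun_prop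
  have h2 := hc.tendsto.comp h1
  simp only [ne_eq, OfNat.ofNat_ne_zero, not_false_eq_true, zero_pow, add_zero, sub_zero,
    Complex.ofReal_one, mul_one, div_one] at h2
  refine h2.congr' ?_
  filter_upwards [eventually_gt_atTop 0] with t ht
  exact (cot_neg_I_mul_ofReal (mul_pos ht hs)).2.symm

/-- A criterion for the WDVV equations: the matrices of third derivatives commute, and in the
asymptotic direction `v` a constant linear combination of them tends to a scalar matrix. -/
theorem prepotentialSatisfiesWDVV_of_commute {N m : ℕ} (C : VectorConfiguration N m)
    (hcomm : ∀ x ∈ regularLocus C, ∀ i j, Commute (cotMatrix C i x) (cotMatrix C j x))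
    (v : Fin N → ℂ) (hv : ∀ k, ∃ s : ℝ, 0 < s ∧ (C k).1 ⬝ᵥ v = s)
    (a : Fin N → ℂ) (κ : ℂ) (hκ : κ ≠ 0)
    (ha : ∀ p q, ∑ k, (C k).2 * ((C k).1 ⬝ᵥ a) * (C k).1 p * (C k).1 q =
      κ * (1 : Matrix (Fin N) (Fin N) ℂ) p q) :
    PrepotentialSatisfiesWDVV C := by
  constructor
  · intro x F hF A hdet i j
    rw [metricMatrix_eq hF] at hdet ⊢
    rw [hF.thirdDerivMatrix_eq, hF.thirdDerivMatrix_eq]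
    exact mul_inv_mul_comm_of_commute _ (hcomm x hF.mem_regularLocus) _ hdet i j
  choose s hs hvs using hv
  have hdot : ∀ (t : ℝ) k, (C k).1 ⬝ᵥ ((-Complex.I * t) • v) = -Complex.I * (t * s k : ℝ) := by
    intro t k
    rw [dotProduct_smul, hvs, smul_eq_mul]
    push_cast
    ring
  have hlim : Tendsto (fun t : ℝ => ∑ i, a i • cotMatrix C i ((-Complex.I * t) • v)) atTop
      (𝓝 ((Complex.I * κ) • (1 : Matrix (Fin N) (Fin N) ℂ))) := by
    refine tendsto_pi_nhds.2 fun p => tendsto_pi_nhds.2 fun q => ?_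
    simp only [sum_smul_cotMatrix_apply, hdot]
    rw [Matrix.smul_apply, smul_eq_mul, mul_assoc, ← ha p q, Finset.mul_sum]
    exact tendsto_finsetSum _ fun k _ => (tendsto_cot_neg_I_mul (hs k)).mul_const _
  have hdetlim := ((continuous_id.matrix_det).tendsto _).comp hlim
  have hne : ((Complex.I * κ) • (1 : Matrix (Fin N) (Fin N) ℂ)).det ≠ 0 := by
    rw [Matrix.det_smul, Matrix.det_one, mul_one]
    exact pow_ne_zero _ (mul_ne_zero Complex.I_ne_zero hκ)
  -- The limiting determinant is (iκ)^N ≠ 0, so some finite t > 0 already gives a non-degenerate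
  -- matrix.
  obtain ⟨t, ht, ht0⟩ := ((hdetlim.eventually_ne hne).and (eventually_gt_atTop 0)).exists
  have hreg : (-Complex.I * t) • v ∈ regularLocus C := by
    intro k
    rw [hdot]
    exact (cot_neg_I_mul_ofReal (mul_pos ht0 (hs k))).1
  -- E is entire, so the identity theorem applies on all of ℂ^N and no connectedness of the regular
  -- locus is needed. The extra factor `sinProd` places the non-vanishing set of E inside the
  -- regular locus.
  set E : (Fin N → ℂ) → ℂ := fun x => (clearedMatrix C a x).det * sinProd C x
  have hE : ∀ x, AnalyticAt ℂ E x := fun x =>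
    (analyticAt_det_clearedMatrix C a x).mul (analyticAt_sinProd C x)
  have hdet_eq : ∀ x ∈ regularLocus C,
      (clearedMatrix C a x).det = sinProd C x ^ N * (∑ i, a i • cotMatrix C i x).det := by
    intro x hx
    rw [← sinProd_smul_sum_smul_cotMatrix a hx, Matrix.det_smul, Fintype.card_fin]
  have hE0 : E ((-Complex.I * t) • v) ≠ 0 := by
    have hS := sinProd_ne_zero_iff.2 hreg
    simp only [E]
    rw [hdet_eq _ hreg]
    exact mul_ne_zero (mul_ne_zero (pow_ne_zero _ hS) ht) hS
  have hU : ∀ x, E x ≠ 0 → x ∈ regularLocus C := fun x hx =>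
    sinProd_ne_zero_iff.1 (right_ne_zero_of_mul hx)
  refine ⟨{x | E x ≠ 0}, ?_, dense_ne_zero_of_analyticOnNhd hE hE0, hU, fun k _ => a k,
    fun k x _ => analyticAt_const, fun x hx F hF => ?_⟩
  · exact isOpen_ne_fun (continuous_iff_continuousAt.2 fun x => (hE x).continuousAt)
      continuous_const
  · rw [metricMatrix_eq hF]
    have h1 := left_ne_zero_of_mul hx
    rw [hdet_eq x (hU x hx)] at h1
    exact right_ne_zero_of_mul h1

/-! ### Algebraic model: cotangents replaced by numbers X_α obeying the addition formula -/

/-- The matrix `∑_α c_α X_α α_i α ⊗ α`, where `X` assigns a number to every vector `α`. -/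
noncomputable def weightedMatrix {N m : ℕ} (C : VectorConfiguration N m) (X : Fin m → ℂ) (i : Fin N) :
    Matrix (Fin N) (Fin N) ℂ :=
  Matrix.of fun p q => ∑ k, (C k).2 * X k * ((C k).1 i * (C k).1 p * (C k).1 q)

lemma weightedMatrix_swap_left {N m : ℕ} (C : VectorConfiguration N m) (X : Fin m → ℂ)
    (i p q : Fin N) : weightedMatrix C X i p q = weightedMatrix C X p i q := by
  simp only [weightedMatrix, Matrix.of_apply]
  exact Finset.sum_congr rfl fun k _ => by ring

lemma weightedMatrix_swap_right {N m : ℕ} (C : VectorConfiguration N m) (X : Fin m → ℂ)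
    (i p q : Fin N) : weightedMatrix C X i p q = weightedMatrix C X i q p := by
  simp only [weightedMatrix, Matrix.of_apply]
  exact Finset.sum_congr rfl fun k _ => by ring

/-- The addition formula of the cotangent, for all relations `α + β = γ` in the configuration. -/
def SatisfiesCotAddition {N m : ℕ} (C : VectorConfiguration N m) (X : Fin m → ℂ) : Prop :=
  ∀ a b c, (C a).1 + (C b).1 = (C c).1 → X a * X b = X c * (X a + X b) + 1

lemma satisfiesCotAddition_cot {N m : ℕ} {C : VectorConfiguration N m} {x : Fin N → ℂ}
    (hx : x ∈ regularLocus C) :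
    SatisfiesCotAddition C fun k => Complex.cot ((C k).1 ⬝ᵥ x) := by
  intro a b c h
  have ha := hx a
  have hb := hx b
  have hc := hx c
  simp only [← h, add_dotProduct, Complex.cot] at hc ⊢
  generalize (C a).1 ⬝ᵥ x = u at *
  generalize (C b).1 ⬝ᵥ x = v at *
  rw [Complex.sin_add] at hc
  rw [Complex.sin_add, Complex.cos_add]
  field_simp
  ring

/-! ### Symmetries of the commutators -/

lemma lt_cases_three (i j : Fin 3) (h : i < j) :
    (i = 0 ∧ j = 1) ∨ (i = 0 ∧ j = 2) ∨ (i = 1 ∧ j = 2) := by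
  revert i j; decide

lemma lt_cases_four (i j : Fin 4) (h : i < j) :
    (i = 0 ∧ j = 1) ∨ (i = 0 ∧ j = 2) ∨ (i = 0 ∧ j = 3) ∨ (i = 1 ∧ j = 2) ∨ (i = 1 ∧ j = 3) ∨
      (i = 2 ∧ j = 3) := by
  revert i j; decide

/-- Total symmetry of the tensor T lets the pairs (i,j) and (p,q) change roles. The commutator [T_i,
T_j]_{pq} therefore has the pair symmetries of a curvature tensor: antisymmetric in ij and in pq,
and invariant under exchanging the pairs. -/
lemma mul_apply_swap_of_symmetric {N : ℕ} {T : Fin N → Matrix (Fin N) (Fin N) ℂ}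
    (h1 : ∀ i p q, T i p q = T p i q) (h2 : ∀ i p q, T i p q = T i q p) (i j p q : Fin N) :
    (T i * T j) p q = (T p * T q) i j := by
  simp only [Matrix.mul_apply]
  refine Finset.sum_congr rfl fun s _ => ?_
  rw [h1 i p s, h2 j s q, h1 j q s, h2 q j s]

lemma mul_apply_comm_of_symmetric {N : ℕ} {T : Fin N → Matrix (Fin N) (Fin N) ℂ}
    (h2 : ∀ i p q, T i p q = T i q p) (i j p q : Fin N) :
    (T i * T j) p q = (T j * T i) q p := by
  simp only [Matrix.mul_apply]
  refine Finset.sum_congr rfl fun s _ => ?_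
  rw [h2 i p s, h2 j s q, mul_comm]

lemma commute_of_symmetric {N : ℕ} {T : Fin N → Matrix (Fin N) (Fin N) ℂ}
    (h2 : ∀ i p q, T i p q = T i q p)
    (h : ∀ i j p q, i < j → p < q → (T i * T j) p q = (T j * T i) p q) (i j : Fin N) :
    Commute (T i) (T j) := by
  have hlt : ∀ i j, i < j → T i * T j = T j * T i := by
    intro i j hij
    ext p q
    rcases lt_trichotomy p q with hpq | rfl | hpq
    · exact h i j p q hij hpq
    · exact mul_apply_comm_of_symmetric h2 i j p p
    · rw [mul_apply_comm_of_symmetric h2 i, mul_apply_comm_of_symmetric h2 j i p q]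
      exact (h i j q p hij hpq).symm
  rcases lt_trichotomy i j with hij | rfl | hij
  · exact hlt i j hij
  · exact Commute.refl _
  · exact (hlt j i hij).symm

lemma commute_of_symmetric_three {T : Fin 3 → Matrix (Fin 3) (Fin 3) ℂ}
    (h1 : ∀ i p q, T i p q = T p i q) (h2 : ∀ i p q, T i p q = T i q p)
    (h : (T 0 * T 1) 0 1 = (T 1 * T 0) 0 1 ∧ (T 0 * T 1) 0 2 = (T 1 * T 0) 0 2 ∧
      (T 0 * T 1) 1 2 = (T 1 * T 0) 1 2 ∧ (T 0 * T 2) 0 2 = (T 2 * T 0) 0 2 ∧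
      (T 0 * T 2) 1 2 = (T 2 * T 0) 1 2 ∧ (T 1 * T 2) 1 2 = (T 2 * T 1) 1 2) (i j : Fin 3) :
    Commute (T i) (T j) := by
  obtain ⟨e0, e1, e2, e3, e4, e5⟩ := h
  refine commute_of_symmetric h2 (fun i j p q hij hpq => ?_) i j
  have hswap : ∀ i j p q, (T p * T q) i j = (T q * T p) i j →
      (T i * T j) p q = (T j * T i) p q := fun i j p q h => by
    rw [mul_apply_swap_of_symmetric h1 h2, h, mul_apply_comm_of_symmetric h2,
      mul_apply_swap_of_symmetric h1 h2]
  rcases lt_cases_three i j hij with ⟨rfl, rfl⟩ | ⟨rfl, rfl⟩ | ⟨rfl, rfl⟩ <;>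
  rcases lt_cases_three p q hpq with ⟨rfl, rfl⟩ | ⟨rfl, rfl⟩ | ⟨rfl, rfl⟩ <;>
  first
  | assumption
  | exact hswap _ _ _ _ (by assumption)

/-- There are 6 index pairs i < j, so pair exchange leaves 6·7/2 = 21 components out of 36; for N =
3 the same count is 3·4/2 = 6 out of 9. -/
lemma commute_of_symmetric_four {T : Fin 4 → Matrix (Fin 4) (Fin 4) ℂ}
    (h1 : ∀ i p q, T i p q = T p i q) (h2 : ∀ i p q, T i p q = T i q p)
    (h : (T 0 * T 1) 0 1 = (T 1 * T 0) 0 1 ∧ (T 0 * T 1) 0 2 = (T 1 * T 0) 0 2 ∧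
      (T 0 * T 1) 0 3 = (T 1 * T 0) 0 3 ∧ (T 0 * T 1) 1 2 = (T 1 * T 0) 1 2 ∧
      (T 0 * T 1) 1 3 = (T 1 * T 0) 1 3 ∧ (T 0 * T 1) 2 3 = (T 1 * T 0) 2 3 ∧
      (T 0 * T 2) 0 2 = (T 2 * T 0) 0 2 ∧ (T 0 * T 2) 0 3 = (T 2 * T 0) 0 3 ∧
      (T 0 * T 2) 1 2 = (T 2 * T 0) 1 2 ∧ (T 0 * T 2) 1 3 = (T 2 * T 0) 1 3 ∧
      (T 0 * T 2) 2 3 = (T 2 * T 0) 2 3 ∧ (T 0 * T 3) 0 3 = (T 3 * T 0) 0 3 ∧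
      (T 0 * T 3) 1 2 = (T 3 * T 0) 1 2 ∧ (T 0 * T 3) 1 3 = (T 3 * T 0) 1 3 ∧
      (T 0 * T 3) 2 3 = (T 3 * T 0) 2 3 ∧ (T 1 * T 2) 1 2 = (T 2 * T 1) 1 2 ∧
      (T 1 * T 2) 1 3 = (T 2 * T 1) 1 3 ∧ (T 1 * T 2) 2 3 = (T 2 * T 1) 2 3 ∧
      (T 1 * T 3) 1 3 = (T 3 * T 1) 1 3 ∧ (T 1 * T 3) 2 3 = (T 3 * T 1) 2 3 ∧
      (T 2 * T 3) 2 3 = (T 3 * T 2) 2 3) (i j : Fin 4) :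
    Commute (T i) (T j) := by
  obtain ⟨e0, e1, e2, e3, e4, e5, e6, e7, e8, e9, e10, e11, e12, e13, e14, e15, e16, e17, e18, e19, e20⟩ := h
  refine commute_of_symmetric h2 (fun i j p q hij hpq => ?_) i j
  have hswap : ∀ i j p q, (T p * T q) i j = (T q * T p) i j →
      (T i * T j) p q = (T j * T i) p q := fun i j p q h => by
    rw [mul_apply_swap_of_symmetric h1 h2, h, mul_apply_comm_of_symmetric h2,
      mul_apply_swap_of_symmetric h1 h2]
  rcases lt_cases_four i j hij with ⟨rfl, rfl⟩ | ⟨rfl, rfl⟩ | ⟨rfl, rfl⟩ | ⟨rfl, rfl⟩ | ⟨rfl, rfl⟩ | ⟨rfl, rfl⟩ <;>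
  rcases lt_cases_four p q hpq with ⟨rfl, rfl⟩ | ⟨rfl, rfl⟩ | ⟨rfl, rfl⟩ | ⟨rfl, rfl⟩ | ⟨rfl, rfl⟩ | ⟨rfl, rfl⟩ <;>
  first
  | assumption
  | exact hswap _ _ _ _ (by assumption)

/-! ### Commutation for F₄⁺ -/

-- Each component of the commutator is an explicit combination of addition relations. The constants
-- left over vanish for components with different index pairs, and give r²+6rq+8q² when the two
-- pairs coincide; only those six components use `hrq`.
set_option maxHeartbeats 4000000 in
lemma F4Plus_commute {r q : ℂ} (hrq : r ^ 2 + 6 * (r * q) + 8 * q ^ 2 = 0) {X : Fin 24 → ℂ}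
    (hX : SatisfiesCotAddition (F4Plus r q) X) (i j : Fin 4) :
    Commute (weightedMatrix (F4Plus r q) X i) (weightedMatrix (F4Plus r q) X j) := by
  have h0 := hX 0 1 4 (by ext i; fin_cases i <;> simp [F4Plus])
  have h1 := hX 0 2 6 (by ext i; fin_cases i <;> simp [F4Plus])
  have h2 := hX 0 3 8 (by ext i; fin_cases i <;> simp [F4Plus])
  have h3 := hX 1 2 10 (by ext i; fin_cases i <;> simp [F4Plus])
  have h4 := hX 1 3 12 (by ext i; fin_cases i <;> simp [F4Plus])
  have h5 := hX 1 5 0 (by ext i; fin_cases i <;> simp [F4Plus])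
  have h6 := hX 1 20 16 (by ext i; fin_cases i <;> simp [F4Plus]; ring)
  have h7 := hX 1 21 17 (by ext i; fin_cases i <;> simp [F4Plus]; ring)
  have h8 := hX 1 22 18 (by ext i; fin_cases i <;> simp [F4Plus]; ring)
  have h9 := hX 1 23 19 (by ext i; fin_cases i <;> simp [F4Plus]; ring)
  have h10 := hX 2 3 14 (by ext i; fin_cases i <;> simp [F4Plus])
  have h11 := hX 2 7 0 (by ext i; fin_cases i <;> simp [F4Plus])
  have h12 := hX 2 11 1 (by ext i; fin_cases i <;> simp [F4Plus])
  have h13 := hX 2 18 16 (by ext i; fin_cases i <;> simp [F4Plus]; ring)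
  have h14 := hX 2 19 17 (by ext i; fin_cases i <;> simp [F4Plus]; ring)
  have h15 := hX 2 22 20 (by ext i; fin_cases i <;> simp [F4Plus]; ring)
  have h16 := hX 2 23 21 (by ext i; fin_cases i <;> simp [F4Plus]; ring)
  have h17 := hX 3 9 0 (by ext i; fin_cases i <;> simp [F4Plus])
  have h18 := hX 3 13 1 (by ext i; fin_cases i <;> simp [F4Plus])
  have h19 := hX 3 15 2 (by ext i; fin_cases i <;> simp [F4Plus])
  have h20 := hX 3 17 16 (by ext i; fin_cases i <;> simp [F4Plus]; ring)
  have h21 := hX 3 19 18 (by ext i; fin_cases i <;> simp [F4Plus]; ring)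
  have h22 := hX 3 21 20 (by ext i; fin_cases i <;> simp [F4Plus]; ring)
  have h23 := hX 3 23 22 (by ext i; fin_cases i <;> simp [F4Plus]; ring)
  have h24 := hX 5 10 6 (by ext i; fin_cases i <;> simp [F4Plus])
  have h25 := hX 5 11 7 (by ext i; fin_cases i <;> simp [F4Plus])
  have h26 := hX 5 12 8 (by ext i; fin_cases i <;> simp [F4Plus])
  have h27 := hX 5 13 9 (by ext i; fin_cases i <;> simp [F4Plus])
  have h28 := hX 6 11 4 (by ext i; fin_cases i <;> simp [F4Plus])
  have h29 := hX 7 10 4 (by ext i; fin_cases i <;> simp [F4Plus])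
  have h30 := hX 7 14 8 (by ext i; fin_cases i <;> simp [F4Plus])
  have h31 := hX 7 15 9 (by ext i; fin_cases i <;> simp [F4Plus])
  have h32 := hX 8 13 4 (by ext i; fin_cases i <;> simp [F4Plus])
  have h33 := hX 8 15 6 (by ext i; fin_cases i <;> simp [F4Plus])
  have h34 := hX 9 12 4 (by ext i; fin_cases i <;> simp [F4Plus])
  have h35 := hX 9 14 6 (by ext i; fin_cases i <;> simp [F4Plus])
  have h36 := hX 10 22 16 (by ext i; fin_cases i <;> simp [F4Plus] <;> ring)
  have h37 := hX 10 23 17 (by ext i; fin_cases i <;> simp [F4Plus] <;> ring)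
  have h38 := hX 11 14 12 (by ext i; fin_cases i <;> simp [F4Plus])
  have h39 := hX 11 15 13 (by ext i; fin_cases i <;> simp [F4Plus])
  have h40 := hX 11 20 18 (by ext i; fin_cases i <;> simp [F4Plus] <;> ring)
  have h41 := hX 11 21 19 (by ext i; fin_cases i <;> simp [F4Plus] <;> ring)
  have h42 := hX 12 15 10 (by ext i; fin_cases i <;> simp [F4Plus])
  have h43 := hX 12 21 16 (by ext i; fin_cases i <;> simp [F4Plus] <;> ring)
  have h44 := hX 12 23 18 (by ext i; fin_cases i <;> simp [F4Plus] <;> ring)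
  have h45 := hX 13 14 10 (by ext i; fin_cases i <;> simp [F4Plus])
  have h46 := hX 13 20 17 (by ext i; fin_cases i <;> simp [F4Plus] <;> ring)
  have h47 := hX 13 22 19 (by ext i; fin_cases i <;> simp [F4Plus] <;> ring)
  have h48 := hX 14 19 16 (by ext i; fin_cases i <;> simp [F4Plus] <;> ring)
  have h49 := hX 14 23 20 (by ext i; fin_cases i <;> simp [F4Plus] <;> ring)
  have h50 := hX 15 18 17 (by ext i; fin_cases i <;> simp [F4Plus] <;> ring)
  have h51 := hX 15 22 21 (by ext i; fin_cases i <;> simp [F4Plus] <;> ring)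
  have h52 := hX 16 19 4 (by ext i; fin_cases i <;> simp [F4Plus] <;> ring)
  have h53 := hX 16 21 6 (by ext i; fin_cases i <;> simp [F4Plus] <;> ring)
  have h54 := hX 16 22 8 (by ext i; fin_cases i <;> simp [F4Plus] <;> ring)
  have h55 := hX 16 23 0 (by ext i; fin_cases i <;> simp [F4Plus] <;> ring)
  have h56 := hX 17 18 4 (by ext i; fin_cases i <;> simp [F4Plus] <;> ring)
  have h57 := hX 17 20 6 (by ext i; fin_cases i <;> simp [F4Plus] <;> ring)
  have h58 := hX 17 22 0 (by ext i; fin_cases i <;> simp [F4Plus] <;> ring)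
  have h59 := hX 17 23 9 (by ext i; fin_cases i <;> simp [F4Plus] <;> ring)
  have h60 := hX 18 20 8 (by ext i; fin_cases i <;> simp [F4Plus] <;> ring)
  have h61 := hX 18 21 0 (by ext i; fin_cases i <;> simp [F4Plus] <;> ring)
  have h62 := hX 18 23 7 (by ext i; fin_cases i <;> simp [F4Plus] <;> ring)
  have h63 := hX 19 20 0 (by ext i; fin_cases i <;> simp [F4Plus] <;> ring)
  have h64 := hX 19 21 9 (by ext i; fin_cases i <;> simp [F4Plus] <;> ring)
  have h65 := hX 19 22 7 (by ext i; fin_cases i <;> simp [F4Plus] <;> ring)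
  have h66 := hX 20 23 5 (by ext i; fin_cases i <;> simp [F4Plus] <;> ring)
  have h67 := hX 21 22 5 (by ext i; fin_cases i <;> simp [F4Plus] <;> ring)
  have hl := weightedMatrix_swap_left (F4Plus r q) X
  have hr := weightedMatrix_swap_right (F4Plus r q) X
  -- The entries of the symmetric tensor are made opaque, so that the matrix products first expand
  -- into short quadratic expressions; each component then unfolds only the entries it contains.
  obtain ⟨u000, hu000⟩ : ∃ u, u = r * X 0 + q * (X 4 + X 5 + X 6 + X 7 + X 8 + X 9) + r / 8 * (X
    16 + X 17 + X 18 + X 19 + X 20 + X 21 + X 22 + X 23) := ⟨_, rfl⟩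
  have ht000 : weightedMatrix (F4Plus r q) X 0 0 0 = u000 := by
    rw [hu000]; simp [weightedMatrix, F4Plus, Fin.sum_univ_succ]; ring
  obtain ⟨u001, hu001⟩ : ∃ u, u = q * (X 4 - X 5) + r / 8 * (X 16 + X 17 + X 18 + X 19 - X 20 - X
    21 - X 22 - X 23) := ⟨_, rfl⟩
  have ht001 : weightedMatrix (F4Plus r q) X 0 0 1 = u001 := by
    rw [hu001]; simp [weightedMatrix, F4Plus, Fin.sum_univ_succ]; ring
  obtain ⟨u002, hu002⟩ : ∃ u, u = q * (X 6 - X 7) + r / 8 * (X 16 + X 17 - X 18 - X 19 + X 20 + X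
    21 - X 22 - X 23) := ⟨_, rfl⟩
  have ht002 : weightedMatrix (F4Plus r q) X 0 0 2 = u002 := by
    rw [hu002]; simp [weightedMatrix, F4Plus, Fin.sum_univ_succ]; ring
  obtain ⟨u003, hu003⟩ : ∃ u, u = q * (X 8 - X 9) + r / 8 * (X 16 - X 17 + X 18 - X 19 + X 20 - X
    21 + X 22 - X 23) := ⟨_, rfl⟩
  have ht003 : weightedMatrix (F4Plus r q) X 0 0 3 = u003 := by
    rw [hu003]; simp [weightedMatrix, F4Plus, Fin.sum_univ_succ]; ring
  obtain ⟨u011, hu011⟩ : ∃ u, u = q * (X 4 + X 5) + r / 8 * (X 16 + X 17 + X 18 + X 19 + X 20 + X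
    21 + X 22 + X 23) := ⟨_, rfl⟩
  have ht011 : weightedMatrix (F4Plus r q) X 0 1 1 = u011 := by
    rw [hu011]; simp [weightedMatrix, F4Plus, Fin.sum_univ_succ]; ring
  obtain ⟨u012, hu012⟩ : ∃ u, u = r / 8 * (X 16 + X 17 - X 18 - X 19 - X 20 - X 21 + X 22 + X 23)
    := ⟨_, rfl⟩
  have ht012 : weightedMatrix (F4Plus r q) X 0 1 2 = u012 := by
    rw [hu012]; simp [weightedMatrix, F4Plus, Fin.sum_univ_succ]; ring
  obtain ⟨u013, hu013⟩ : ∃ u, u = r / 8 * (X 16 - X 17 + X 18 - X 19 - X 20 + X 21 - X 22 + X 23)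
    := ⟨_, rfl⟩
  have ht013 : weightedMatrix (F4Plus r q) X 0 1 3 = u013 := by
    rw [hu013]; simp [weightedMatrix, F4Plus, Fin.sum_univ_succ]; ring
  obtain ⟨u022, hu022⟩ : ∃ u, u = q * (X 6 + X 7) + r / 8 * (X 16 + X 17 + X 18 + X 19 + X 20 + X
    21 + X 22 + X 23) := ⟨_, rfl⟩
  have ht022 : weightedMatrix (F4Plus r q) X 0 2 2 = u022 := by
    rw [hu022]; simp [weightedMatrix, F4Plus, Fin.sum_univ_succ]; ring
  obtain ⟨u023, hu023⟩ : ∃ u, u = r / 8 * (X 16 - X 17 - X 18 + X 19 + X 20 - X 21 - X 22 + X 23)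
    := ⟨_, rfl⟩
  have ht023 : weightedMatrix (F4Plus r q) X 0 2 3 = u023 := by
    rw [hu023]; simp [weightedMatrix, F4Plus, Fin.sum_univ_succ]; ring
  obtain ⟨u033, hu033⟩ : ∃ u, u = q * (X 8 + X 9) + r / 8 * (X 16 + X 17 + X 18 + X 19 + X 20 + X
    21 + X 22 + X 23) := ⟨_, rfl⟩
  have ht033 : weightedMatrix (F4Plus r q) X 0 3 3 = u033 := by
    rw [hu033]; simp [weightedMatrix, F4Plus, Fin.sum_univ_succ]; ring
  obtain ⟨u111, hu111⟩ : ∃ u, u = r * X 1 + q * (X 4 - X 5 + X 10 + X 11 + X 12 + X 13) + r / 8 *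
    (X 16 + X 17 + X 18 + X 19 - X 20 - X 21 - X 22 - X 23) := ⟨_, rfl⟩
  have ht111 : weightedMatrix (F4Plus r q) X 1 1 1 = u111 := by
    rw [hu111]; simp [weightedMatrix, F4Plus, Fin.sum_univ_succ]; ring
  obtain ⟨u112, hu112⟩ : ∃ u, u = q * (X 10 - X 11) + r / 8 * (X 16 + X 17 - X 18 - X 19 + X 20 +
    X 21 - X 22 - X 23) := ⟨_, rfl⟩
  have ht112 : weightedMatrix (F4Plus r q) X 1 1 2 = u112 := by
    rw [hu112]; simp [weightedMatrix, F4Plus, Fin.sum_univ_succ]; ring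
  obtain ⟨u113, hu113⟩ : ∃ u, u = q * (X 12 - X 13) + r / 8 * (X 16 - X 17 + X 18 - X 19 + X 20 -
    X 21 + X 22 - X 23) := ⟨_, rfl⟩
  have ht113 : weightedMatrix (F4Plus r q) X 1 1 3 = u113 := by
    rw [hu113]; simp [weightedMatrix, F4Plus, Fin.sum_univ_succ]; ring
  obtain ⟨u122, hu122⟩ : ∃ u, u = q * (X 10 + X 11) + r / 8 * (X 16 + X 17 + X 18 + X 19 - X 20 -
    X 21 - X 22 - X 23) := ⟨_, rfl⟩
  have ht122 : weightedMatrix (F4Plus r q) X 1 2 2 = u122 := by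
    rw [hu122]; simp [weightedMatrix, F4Plus, Fin.sum_univ_succ]; ring
  obtain ⟨u123, hu123⟩ : ∃ u, u = r / 8 * (X 16 - X 17 - X 18 + X 19 - X 20 + X 21 + X 22 - X 23)
    := ⟨_, rfl⟩
  have ht123 : weightedMatrix (F4Plus r q) X 1 2 3 = u123 := by
    rw [hu123]; simp [weightedMatrix, F4Plus, Fin.sum_univ_succ]; ring
  obtain ⟨u133, hu133⟩ : ∃ u, u = q * (X 12 + X 13) + r / 8 * (X 16 + X 17 + X 18 + X 19 - X 20 -
    X 21 - X 22 - X 23) := ⟨_, rfl⟩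
  have ht133 : weightedMatrix (F4Plus r q) X 1 3 3 = u133 := by
    rw [hu133]; simp [weightedMatrix, F4Plus, Fin.sum_univ_succ]; ring
  obtain ⟨u222, hu222⟩ : ∃ u, u = r * X 2 + q * (X 6 - X 7 + X 10 - X 11 + X 14 + X 15) + r / 8 *
    (X 16 + X 17 - X 18 - X 19 + X 20 + X 21 - X 22 - X 23) := ⟨_, rfl⟩
  have ht222 : weightedMatrix (F4Plus r q) X 2 2 2 = u222 := by
    rw [hu222]; simp [weightedMatrix, F4Plus, Fin.sum_univ_succ]; ring
  obtain ⟨u223, hu223⟩ : ∃ u, u = q * (X 14 - X 15) + r / 8 * (X 16 - X 17 + X 18 - X 19 + X 20 -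
    X 21 + X 22 - X 23) := ⟨_, rfl⟩
  have ht223 : weightedMatrix (F4Plus r q) X 2 2 3 = u223 := by
    rw [hu223]; simp [weightedMatrix, F4Plus, Fin.sum_univ_succ]; ring
  obtain ⟨u233, hu233⟩ : ∃ u, u = q * (X 14 + X 15) + r / 8 * (X 16 + X 17 - X 18 - X 19 + X 20 +
    X 21 - X 22 - X 23) := ⟨_, rfl⟩
  have ht233 : weightedMatrix (F4Plus r q) X 2 3 3 = u233 := by
    rw [hu233]; simp [weightedMatrix, F4Plus, Fin.sum_univ_succ]; ring
  obtain ⟨u333, hu333⟩ : ∃ u, u = r * X 3 + q * (X 8 - X 9 + X 12 - X 13 + X 14 - X 15) + r / 8 *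
    (X 16 - X 17 + X 18 - X 19 + X 20 - X 21 + X 22 - X 23) := ⟨_, rfl⟩
  have ht333 : weightedMatrix (F4Plus r q) X 3 3 3 = u333 := by
    rw [hu333]; simp [weightedMatrix, F4Plus, Fin.sum_univ_succ]; ring
  refine commute_of_symmetric_four hl hr ?_ i j
  simp only [Matrix.mul_apply, Fin.sum_univ_four, hl, hr, ht000, ht001, ht002, ht003, ht011, ht012, ht013, ht022, ht023, ht033, ht111, ht112, ht113, ht122, ht123, ht133, ht222, ht223, ht233, ht333]
  refine ⟨?_, ?_, ?_, ?_, ?_, ?_, ?_, ?_, ?_, ?_, ?_, ?_, ?_, ?_, ?_, ?_, ?_, ?_, ?_, ?_, ?_⟩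
  · rw [hu000, hu001, hu002, hu003, hu011, hu012, hu013, hu111, hu112, hu113]
    -- Relations `h0` and `h5` occur with equal weight because e₁ and e₂ are orthogonal: X 0 * X 1
    -- is absent from the commutator and has to cancel between the two. The weights of all relations
    -- add up to -(r²+6rq+8q²), which the term `hrq` compensates.
    linear_combination -r * q * (h0 + h5) - r ^ 2 / 8 * (h6 + h7 + h8 + h9 + h55 + h58 + h61 +
      h63) - q ^ 2 * (h24 + h25 + h26 + h27 + h28 + h29 + h32 + h34) - r * q / 4 * (h36 + h37 +
      h40 + h41 + h43 + h44 + h46 + h47 + h53 + h54 + h57 + h59 + h60 + h62 + h64 + h65) - hrq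
  · rw [hu000, hu001, hu002, hu003, hu011, hu012, hu013, hu022, hu023, hu112, hu122, hu123]
    linear_combination -q ^ 2 * (h24 - h25 - h28 + h29) - r * q / 4 * (h36 + h37 - h40 - h41 +
      h54 + h59 - h60 - h64) - r ^ 2 / 8 * (h55 + h58 - h61 - h63)
  · rw [hu000, hu001, hu002, hu003, hu011, hu012, hu013, hu023, hu033, hu113, hu123, hu133]
    linear_combination -q ^ 2 * (h26 - h27 - h32 + h34) - r * q / 4 * (h43 + h44 - h46 - h47 +
      h53 - h57 + h62 - h65) - r ^ 2 / 8 * (h55 - h58 + h61 - h63)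
  · rw [hu001, hu002, hu011, hu012, hu013, hu022, hu023, hu111, hu112, hu113, hu122, hu123]
    linear_combination r ^ 2 / 8 * (h6 + h7 - h8 - h9) + q ^ 2 * (h24 - h25 + h28 - h29) + r * q
      / 4 * (h43 - h44 + h46 - h47 + h53 + h57 - h62 - h65)
  · rw [hu001, hu003, hu011, hu012, hu013, hu023, hu033, hu111, hu112, hu113, hu123, hu133]
    linear_combination r ^ 2 / 8 * (h6 - h7 + h8 - h9) + q ^ 2 * (h26 - h27 + h32 - h34) + r * q
      / 4 * (h36 - h37 + h40 - h41 + h54 - h59 + h60 - h64)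
  · rw [hu002, hu003, hu012, hu013, hu022, hu023, hu033, hu112, hu113, hu122, hu123, hu133]
    linear_combination r * q / 4 * (h36 - h37 - h40 + h41 - h43 + h44 + h46 - h47 - h53 + h54 +
      h57 - h59 - h60 + h62 + h64 - h65)
  · rw [hu000, hu001, hu002, hu003, hu012, hu022, hu023, hu122, hu222, hu223]
    linear_combination -r * q * (h1 + h11) - r ^ 2 / 8 * (h13 + h14 + h15 + h16 + h55 + h58 + h61
      + h63) - q ^ 2 * (h24 + h25 + h28 + h29 + h30 + h31 + h33 + h35) - r * q / 4 * (h36 + h37 +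
      h40 + h41 + h48 + h49 + h50 + h51 + h52 + h54 + h56 + h59 + h60 + h64 + h66 + h67) - hrq
  · rw [hu000, hu001, hu002, hu003, hu012, hu013, hu022, hu023, hu033, hu123, hu223, hu233]
    linear_combination -q ^ 2 * (h30 - h31 - h33 + h35) - r * q / 4 * (h48 + h49 - h50 - h51 +
      h52 - h56 + h66 - h67) - r ^ 2 / 8 * (h55 - h58 - h61 + h63)
  · rw [hu001, hu002, hu011, hu012, hu013, hu022, hu023, hu112, hu122, hu123, hu222, hu223]
    linear_combination -r ^ 2 / 8 * (h13 + h14 - h15 - h16) + q ^ 2 * (h24 + h25 - h28 - h29) - r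
      * q / 4 * (h48 - h49 + h50 - h51 + h52 + h56 - h66 - h67)
  · rw [hu001, hu003, hu011, hu012, hu013, hu023, hu033, hu112, hu122, hu123, hu223, hu233]
    linear_combination r * q / 4 * (h36 - h37 - h40 + h41 - h48 + h49 + h50 - h51 - h52 + h54 +
      h56 - h59 - h60 + h64 + h66 - h67)
  · rw [hu002, hu003, hu012, hu013, hu022, hu023, hu033, hu122, hu123, hu222, hu223, hu233]
    linear_combination r ^ 2 / 8 * (h13 - h14 + h15 - h16) + q ^ 2 * (h30 - h31 + h33 - h35) + r
      * q / 4 * (h36 - h37 + h40 - h41 + h54 - h59 + h60 - h64)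
  · rw [hu000, hu001, hu002, hu003, hu013, hu023, hu033, hu133, hu233, hu333]
    linear_combination -r * q * (h2 + h17) - r ^ 2 / 8 * (h20 + h21 + h22 + h23 + h55 + h58 + h61
      + h63) - q ^ 2 * (h26 + h27 + h30 + h31 + h32 + h33 + h34 + h35) - r * q / 4 * (h43 + h44 +
      h46 + h47 + h48 + h49 + h50 + h51 + h52 + h53 + h56 + h57 + h62 + h65 + h66 + h67) - hrq
  · rw [hu001, hu002, hu011, hu012, hu013, hu022, hu023, hu113, hu123, hu133, hu223, hu233]
    linear_combination r * q / 4 * (h43 - h44 - h46 + h47 - h48 + h49 + h50 - h51 - h52 + h53 +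
      h56 - h57 - h62 + h65 + h66 - h67)
  · rw [hu001, hu003, hu011, hu012, hu013, hu023, hu033, hu113, hu123, hu133, hu233, hu333]
    linear_combination -r ^ 2 / 8 * (h20 + h21 - h22 - h23) + q ^ 2 * (h26 + h27 - h32 - h34) - r
      * q / 4 * (h48 - h49 + h50 - h51 + h52 + h56 - h66 - h67)
  · rw [hu002, hu003, hu012, hu013, hu022, hu023, hu033, hu123, hu133, hu223, hu233, hu333]
    linear_combination -r ^ 2 / 8 * (h20 - h21 + h22 - h23) + q ^ 2 * (h30 + h31 - h33 - h35) - r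
      * q / 4 * (h43 - h44 + h46 - h47 + h53 + h57 - h62 - h65)
  · rw [hu011, hu012, hu022, hu111, hu112, hu113, hu122, hu123, hu222, hu223]
    linear_combination -r * q * (h3 + h12) - r ^ 2 / 8 * (h6 + h7 + h8 + h9 + h13 + h14 + h15 +
      h16) - q ^ 2 * (h24 + h25 + h28 + h29 + h38 + h39 + h42 + h45) - r * q / 4 * (h43 + h44 +
      h46 + h47 + h48 + h49 + h50 + h51 + h52 + h53 + h56 + h57 + h62 + h65 + h66 + h67) - hrq
  · rw [hu011, hu012, hu013, hu023, hu111, hu112, hu113, hu122, hu123, hu133, hu223, hu233]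
    linear_combination -r ^ 2 / 8 * (h6 - h7 - h8 + h9) - q ^ 2 * (h38 - h39 - h42 + h45) - r * q
      / 4 * (h48 + h49 - h50 - h51 + h52 - h56 + h66 - h67)
  · rw [hu012, hu013, hu022, hu023, hu112, hu113, hu122, hu123, hu133, hu222, hu223, hu233]
    linear_combination r ^ 2 / 8 * (h13 - h14 - h15 + h16) + q ^ 2 * (h38 - h39 + h42 - h45) + r
      * q / 4 * (h43 + h44 - h46 - h47 + h53 - h57 + h62 - h65)
  · rw [hu011, hu013, hu033, hu111, hu112, hu113, hu123, hu133, hu233, hu333]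
    linear_combination -r * q * (h4 + h18) - r ^ 2 / 8 * (h6 + h7 + h8 + h9 + h20 + h21 + h22 +
      h23) - q ^ 2 * (h26 + h27 + h32 + h34 + h38 + h39 + h42 + h45) - r * q / 4 * (h36 + h37 +
      h40 + h41 + h48 + h49 + h50 + h51 + h52 + h54 + h56 + h59 + h60 + h64 + h66 + h67) - hrq
  · rw [hu012, hu013, hu023, hu033, hu112, hu113, hu122, hu123, hu133, hu223, hu233, hu333]
    linear_combination -r ^ 2 / 8 * (h20 - h21 - h22 + h23) - r * q / 4 * (h36 + h37 - h40 - h41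
      + h54 + h59 - h60 - h64) + q ^ 2 * (h38 + h39 - h42 - h45)
  · rw [hu022, hu023, hu033, hu122, hu123, hu133, hu222, hu223, hu233, hu333]
    linear_combination -r * q * (h10 + h19) - r ^ 2 / 8 * (h13 + h14 + h15 + h16 + h20 + h21 +
      h22 + h23) - q ^ 2 * (h30 + h31 + h33 + h35 + h38 + h39 + h42 + h45) - r * q / 4 * (h36 +
      h37 + h40 + h41 + h43 + h44 + h46 + h47 + h53 + h54 + h57 + h59 + h60 + h62 + h64 + h65) -
      hrq

/-! ### Commutation for (F₄, A₁)₁ -/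

lemma F4A1One_commute {r q : ℂ} (hrq : r ^ 2 + 6 * (r * q) + 8 * q ^ 2 = 0) {X : Fin 13 → ℂ}
    (hX : SatisfiesCotAddition (F4A1One r q) X) (i j : Fin 3) :
    Commute (weightedMatrix (F4A1One r q) X i) (weightedMatrix (F4A1One r q) X j) := by
  have h0 := hX 0 1 3 (by ext i; fin_cases i <;> simp [F4A1One])
  have h1 := hX 0 2 5 (by ext i; fin_cases i <;> simp [F4A1One])
  have h2 := hX 1 2 7 (by ext i; fin_cases i <;> simp [F4A1One])
  have h3 := hX 1 4 0 (by ext i; fin_cases i <;> simp [F4A1One])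
  have h4 := hX 1 11 9 (by ext i; fin_cases i <;> simp [F4A1One]; ring)
  have h5 := hX 1 12 10 (by ext i; fin_cases i <;> simp [F4A1One]; ring)
  have h6 := hX 2 6 0 (by ext i; fin_cases i <;> simp [F4A1One])
  have h7 := hX 2 8 1 (by ext i; fin_cases i <;> simp [F4A1One])
  have h8 := hX 2 10 9 (by ext i; fin_cases i <;> simp [F4A1One]; ring)
  have h9 := hX 2 12 11 (by ext i; fin_cases i <;> simp [F4A1One]; ring)
  have h10 := hX 4 7 5 (by ext i; fin_cases i <;> simp [F4A1One])
  have h11 := hX 4 8 6 (by ext i; fin_cases i <;> simp [F4A1One])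
  have h12 := hX 5 8 3 (by ext i; fin_cases i <;> simp [F4A1One])
  have h13 := hX 6 7 3 (by ext i; fin_cases i <;> simp [F4A1One])
  have h14 := hX 7 12 9 (by ext i; fin_cases i <;> simp [F4A1One] <;> ring)
  have h15 := hX 8 11 10 (by ext i; fin_cases i <;> simp [F4A1One] <;> ring)
  have h16 := hX 9 10 3 (by ext i; fin_cases i <;> simp [F4A1One] <;> ring)
  have h17 := hX 9 11 5 (by ext i; fin_cases i <;> simp [F4A1One] <;> ring)
  have h18 := hX 9 12 0 (by ext i; fin_cases i <;> simp [F4A1One] <;> ring)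
  have h19 := hX 10 11 0 (by ext i; fin_cases i <;> simp [F4A1One] <;> ring)
  have h20 := hX 10 12 6 (by ext i; fin_cases i <;> simp [F4A1One] <;> ring)
  have h21 := hX 11 12 4 (by ext i; fin_cases i <;> simp [F4A1One] <;> ring)
  have hl := weightedMatrix_swap_left (F4A1One r q) X
  have hr := weightedMatrix_swap_right (F4A1One r q) X
  obtain ⟨u000, hu000⟩ : ∃ u, u = (r + 2 * q) * X 0 + q * (X 3 + X 4 + X 5 + X 6) + r / 4 * (X 9
    + X 10 + X 11 + X 12) := ⟨_, rfl⟩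
  have ht000 : weightedMatrix (F4A1One r q) X 0 0 0 = u000 := by
    rw [hu000]; simp [weightedMatrix, F4A1One, Fin.sum_univ_succ]; ring
  obtain ⟨u001, hu001⟩ : ∃ u, u = q * (X 3 - X 4) + r / 4 * (X 9 + X 10 - X 11 - X 12) := ⟨_,
    rfl⟩
  have ht001 : weightedMatrix (F4A1One r q) X 0 0 1 = u001 := by
    rw [hu001]; simp [weightedMatrix, F4A1One, Fin.sum_univ_succ]; ring
  obtain ⟨u002, hu002⟩ : ∃ u, u = q * (X 5 - X 6) + r / 4 * (X 9 - X 10 + X 11 - X 12) := ⟨_,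
    rfl⟩
  have ht002 : weightedMatrix (F4A1One r q) X 0 0 2 = u002 := by
    rw [hu002]; simp [weightedMatrix, F4A1One, Fin.sum_univ_succ]; ring
  obtain ⟨u011, hu011⟩ : ∃ u, u = q * (X 3 + X 4) + r / 4 * (X 9 + X 10 + X 11 + X 12) := ⟨_,
    rfl⟩
  have ht011 : weightedMatrix (F4A1One r q) X 0 1 1 = u011 := by
    rw [hu011]; simp [weightedMatrix, F4A1One, Fin.sum_univ_succ]; ring
  obtain ⟨u012, hu012⟩ : ∃ u, u = r / 4 * (X 9 - X 10 - X 11 + X 12) := ⟨_, rfl⟩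
  have ht012 : weightedMatrix (F4A1One r q) X 0 1 2 = u012 := by
    rw [hu012]; simp [weightedMatrix, F4A1One, Fin.sum_univ_succ]; ring
  obtain ⟨u022, hu022⟩ : ∃ u, u = q * (X 5 + X 6) + r / 4 * (X 9 + X 10 + X 11 + X 12) := ⟨_,
    rfl⟩
  have ht022 : weightedMatrix (F4A1One r q) X 0 2 2 = u022 := by
    rw [hu022]; simp [weightedMatrix, F4A1One, Fin.sum_univ_succ]; ring
  obtain ⟨u111, hu111⟩ : ∃ u, u = (r + 2 * q) * X 1 + q * (X 3 - X 4 + X 7 + X 8) + r / 4 * (X 9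
    + X 10 - X 11 - X 12) := ⟨_, rfl⟩
  have ht111 : weightedMatrix (F4A1One r q) X 1 1 1 = u111 := by
    rw [hu111]; simp [weightedMatrix, F4A1One, Fin.sum_univ_succ]; ring
  obtain ⟨u112, hu112⟩ : ∃ u, u = q * (X 7 - X 8) + r / 4 * (X 9 - X 10 + X 11 - X 12) := ⟨_,
    rfl⟩
  have ht112 : weightedMatrix (F4A1One r q) X 1 1 2 = u112 := by
    rw [hu112]; simp [weightedMatrix, F4A1One, Fin.sum_univ_succ]; ring
  obtain ⟨u122, hu122⟩ : ∃ u, u = q * (X 7 + X 8) + r / 4 * (X 9 + X 10 - X 11 - X 12) := ⟨_,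
    rfl⟩
  have ht122 : weightedMatrix (F4A1One r q) X 1 2 2 = u122 := by
    rw [hu122]; simp [weightedMatrix, F4A1One, Fin.sum_univ_succ]; ring
  obtain ⟨u222, hu222⟩ : ∃ u, u = (r + 2 * q) * X 2 + q * (X 5 - X 6 + X 7 - X 8) + r / 4 * (X 9
    - X 10 + X 11 - X 12) := ⟨_, rfl⟩
  have ht222 : weightedMatrix (F4A1One r q) X 2 2 2 = u222 := by
    rw [hu222]; simp [weightedMatrix, F4A1One, Fin.sum_univ_succ]; ring
  refine commute_of_symmetric_three hl hr ?_ i j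
  simp only [Matrix.mul_apply, Fin.sum_univ_three, hl, hr, ht000, ht001, ht002, ht011, ht012, ht022, ht111, ht112, ht122, ht222]
  refine ⟨?_, ?_, ?_, ?_, ?_, ?_⟩
  · rw [hu000, hu001, hu002, hu011, hu012, hu111, hu112]
    linear_combination -(r * q + 2 * q ^ 2) * (h0 + h3) - (r ^ 2 / 4 + r * q / 2) * (h4 + h5 +
      h18 + h19) - q ^ 2 * (h10 + h11 + h12 + h13) - r * q / 2 * (h14 + h15 + h17 + h20) - hrq
  · rw [hu000, hu001, hu002, hu011, hu012, hu022, hu112, hu122]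
    linear_combination -q ^ 2 * (h10 - h11 - h12 + h13) - r * q / 2 * (h14 - h15) - (r ^ 2 / 4 +
      r * q / 2) * (h18 - h19)
  · rw [hu001, hu002, hu011, hu012, hu022, hu111, hu112, hu122]
    linear_combination (r ^ 2 / 4 + r * q / 2) * (h4 - h5) + q ^ 2 * (h10 - h11 + h12 - h13) + r
      * q / 2 * (h17 - h20)
  · rw [hu000, hu001, hu002, hu012, hu022, hu122, hu222]
    linear_combination -(r * q + 2 * q ^ 2) * (h1 + h6) - (r ^ 2 / 4 + r * q / 2) * (h8 + h9 +
      h18 + h19) - q ^ 2 * (h10 + h11 + h12 + h13) - r * q / 2 * (h14 + h15 + h16 + h21) - hrq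
  · rw [hu001, hu002, hu011, hu012, hu022, hu112, hu122, hu222]
    linear_combination -(r ^ 2 / 4 + r * q / 2) * (h8 - h9) + q ^ 2 * (h10 + h11 - h12 - h13) - r
      * q / 2 * (h16 - h21)
  · rw [hu011, hu012, hu022, hu111, hu112, hu122, hu222]
    linear_combination -(r * q + 2 * q ^ 2) * (h2 + h7) - (r ^ 2 / 4 + r * q / 2) * (h4 + h5 + h8
      + h9) - q ^ 2 * (h10 + h11 + h12 + h13) - r * q / 2 * (h16 + h17 + h20 + h21) - hrq

/-! ### Commutation for (F₄, A₁)₂ -/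

lemma sqrtTwo_sq : sqrtTwo ^ 2 = 2 := by
  rw [sqrtTwo, ← Complex.ofReal_pow, Real.sq_sqrt (by norm_num)]
  norm_num

lemma F4A1Two_commute {r q : ℂ} (hrq : r ^ 2 + 6 * (r * q) + 8 * q ^ 2 = 0) {X : Fin 16 → ℂ}
    (hX : SatisfiesCotAddition (F4A1Two r q) X) (i j : Fin 3) :
    Commute (weightedMatrix (F4A1Two r q) X i) (weightedMatrix (F4A1Two r q) X j) := by
  have hs : sqrtTwo ^ 2 = 2 := sqrtTwo_sq
  have h0 := hX 0 1 4 (by ext i; fin_cases i <;> simp [F4A1Two])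
  have h1 := hX 0 3 8 (by ext i; fin_cases i <;> simp [F4A1Two])
  have h2 := hX 1 3 10 (by ext i; fin_cases i <;> simp [F4A1Two])
  have h3 := hX 1 5 0 (by ext i; fin_cases i <;> simp [F4A1Two])
  have h4 := hX 1 7 6 (by ext i; fin_cases i <;> simp [F4A1Two]; ring)
  have h5 := hX 1 14 12 (by ext i; fin_cases i <;> simp [F4A1Two]; ring)
  have h6 := hX 1 15 13 (by ext i; fin_cases i <;> simp [F4A1Two]; ring)
  have h7 := hX 2 9 8 (by ext i; fin_cases i <;> simp [F4A1Two]; ring)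
  have h8 := hX 2 11 10 (by ext i; fin_cases i <;> simp [F4A1Two]; ring)
  have h9 := hX 2 13 12 (by ext i; fin_cases i <;> simp [F4A1Two]; ring)
  have h10 := hX 2 15 14 (by ext i; fin_cases i <;> simp [F4A1Two]; ring)
  have h11 := hX 3 6 12 (by ext i; fin_cases i <;> simp [F4A1Two])
  have h12 := hX 3 7 14 (by ext i; fin_cases i <;> simp [F4A1Two])
  have h13 := hX 3 9 0 (by ext i; fin_cases i <;> simp [F4A1Two]; ring)
  have h14 := hX 3 11 1 (by ext i; fin_cases i <;> simp [F4A1Two]; ring)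
  have h15 := hX 3 13 6 (by ext i; fin_cases i <;> simp [F4A1Two]; ring)
  have h16 := hX 3 15 7 (by ext i; fin_cases i <;> simp [F4A1Two]; ring)
  have h17 := hX 5 10 8 (by ext i; fin_cases i <;> simp [F4A1Two])
  have h18 := hX 5 11 9 (by ext i; fin_cases i <;> simp [F4A1Two])
  have h19 := hX 6 7 0 (by ext i; fin_cases i <;> simp [F4A1Two] <;> ring)
  have h20 := hX 6 14 8 (by ext i; fin_cases i <;> simp [F4A1Two] <;> ring)
  have h21 := hX 6 15 9 (by ext i; fin_cases i <;> simp [F4A1Two] <;> ring)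
  have h22 := hX 7 10 12 (by ext i; fin_cases i <;> simp [F4A1Two]; ring)
  have h23 := hX 7 11 13 (by ext i; fin_cases i <;> simp [F4A1Two]; ring)
  have h24 := hX 7 12 8 (by ext i; fin_cases i <;> simp [F4A1Two] <;> ring)
  have h25 := hX 7 13 9 (by ext i; fin_cases i <;> simp [F4A1Two] <;> ring)
  have h26 := hX 8 11 4 (by ext i; fin_cases i <;> simp [F4A1Two]; ring)
  have h27 := hX 9 10 4 (by ext i; fin_cases i <;> simp [F4A1Two]; ring)
  have h28 := hX 10 15 6 (by ext i; fin_cases i <;> simp [F4A1Two] <;> ring)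
  have h29 := hX 11 14 6 (by ext i; fin_cases i <;> simp [F4A1Two] <;> ring)
  have h30 := hX 12 13 4 (by ext i; fin_cases i <;> simp [F4A1Two] <;> ring)
  have h31 := hX 12 15 0 (by ext i; fin_cases i <;> simp [F4A1Two] <;> ring)
  have h32 := hX 13 14 0 (by ext i; fin_cases i <;> simp [F4A1Two] <;> ring)
  have h33 := hX 14 15 5 (by ext i; fin_cases i <;> simp [F4A1Two] <;> ring)
  have hl := weightedMatrix_swap_left (F4A1Two r q) X
  have hr := weightedMatrix_swap_right (F4A1Two r q) X
  -- One factor √2 is split off for each index equal to the third coordinate, so the remaining u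
  -- have rational coefficients in r, q and X. A contracted third index then contributes √2² = 2,
  -- which is the factor 2 in the identities `h` below.
  obtain ⟨u000, hu000⟩ : ∃ u, u = r * X 0 + q * (X 4 + X 5) + r / 4 * (X 6 + X 7) + 2 * q * (X 8
    + X 9) + r / 8 * (X 12 + X 13 + X 14 + X 15) := ⟨_, rfl⟩
  have ht000 : weightedMatrix (F4A1Two r q) X 0 0 0 = u000 := by
    rw [hu000]; simp [weightedMatrix, F4A1Two, Fin.sum_univ_succ]; ring
  obtain ⟨u001, hu001⟩ : ∃ u, u = q * (X 4 - X 5) + r / 4 * (X 6 - X 7) + r / 8 * (X 12 + X 13 -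
    X 14 - X 15) := ⟨_, rfl⟩
  have ht001 : weightedMatrix (F4A1Two r q) X 0 0 1 = u001 := by
    rw [hu001]; simp [weightedMatrix, F4A1Two, Fin.sum_univ_succ]; ring
  obtain ⟨u002, hu002⟩ : ∃ u, u = q * (X 8 - X 9) + r / 8 * (X 12 - X 13 + X 14 - X 15) := ⟨_,
    rfl⟩
  have ht002 : weightedMatrix (F4A1Two r q) X 0 0 2 = sqrtTwo * u002 := by
    rw [hu002]; simp [weightedMatrix, F4A1Two, Fin.sum_univ_succ]; ring
  obtain ⟨u011, hu011⟩ : ∃ u, u = q * (X 4 + X 5) + r / 4 * (X 6 + X 7) + r / 8 * (X 12 + X 13 +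
    X 14 + X 15) := ⟨_, rfl⟩
  have ht011 : weightedMatrix (F4A1Two r q) X 0 1 1 = u011 := by
    rw [hu011]; simp [weightedMatrix, F4A1Two, Fin.sum_univ_succ]; ring
  obtain ⟨u012, hu012⟩ : ∃ u, u = r / 8 * (X 12 - X 13 - X 14 + X 15) := ⟨_, rfl⟩
  have ht012 : weightedMatrix (F4A1Two r q) X 0 1 2 = sqrtTwo * u012 := by
    rw [hu012]; simp [weightedMatrix, F4A1Two, Fin.sum_univ_succ]; ring
  obtain ⟨u022, hu022⟩ : ∃ u, u = q / 2 * (X 8 + X 9) + r / 8 * (X 12 + X 13 + X 14 + X 15) :=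
    ⟨_, rfl⟩
  have ht022 : weightedMatrix (F4A1Two r q) X 0 2 2 = sqrtTwo ^ 2 * u022 := by
    rw [hu022]; simp [weightedMatrix, F4A1Two, Fin.sum_univ_succ]; ring
  obtain ⟨u111, hu111⟩ : ∃ u, u = r * X 1 + q * (X 4 - X 5) + r / 4 * (X 6 - X 7) + 2 * q * (X 10
    + X 11) + r / 8 * (X 12 + X 13 - X 14 - X 15) := ⟨_, rfl⟩
  have ht111 : weightedMatrix (F4A1Two r q) X 1 1 1 = u111 := by
    rw [hu111]; simp [weightedMatrix, F4A1Two, Fin.sum_univ_succ]; ring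
  obtain ⟨u112, hu112⟩ : ∃ u, u = q * (X 10 - X 11) + r / 8 * (X 12 - X 13 + X 14 - X 15) := ⟨_,
    rfl⟩
  have ht112 : weightedMatrix (F4A1Two r q) X 1 1 2 = sqrtTwo * u112 := by
    rw [hu112]; simp [weightedMatrix, F4A1Two, Fin.sum_univ_succ]; ring
  obtain ⟨u122, hu122⟩ : ∃ u, u = q / 2 * (X 10 + X 11) + r / 8 * (X 12 + X 13 - X 14 - X 15) :=
    ⟨_, rfl⟩
  have ht122 : weightedMatrix (F4A1Two r q) X 1 2 2 = sqrtTwo ^ 2 * u122 := by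
    rw [hu122]; simp [weightedMatrix, F4A1Two, Fin.sum_univ_succ]; ring
  obtain ⟨u222, hu222⟩ : ∃ u, u = q * X 2 + r / 4 * X 3 + q / 4 * (X 8 - X 9 + X 10 - X 11) + r /
    8 * (X 12 - X 13 + X 14 - X 15) := ⟨_, rfl⟩
  have ht222 : weightedMatrix (F4A1Two r q) X 2 2 2 = sqrtTwo ^ 3 * u222 := by
    rw [hu222]; simp [weightedMatrix, F4A1Two, Fin.sum_univ_succ]; ring
  refine commute_of_symmetric_three hl hr ?_ i j
  simp only [Matrix.mul_apply, Fin.sum_univ_three, hl, hr, ht000, ht001, ht002, ht011, ht012, ht022, ht111, ht112, ht122, ht222]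
  refine ⟨?_, ?_, ?_, ?_, ?_, ?_⟩
  · have h : u000 * u011 - u001 * u001 + (u001 * u111 - u011 * u011) + 2 * (u002 * u112 - u012 *
    u012) = 0 := by
      rw [hu000, hu001, hu002, hu011, hu012, hu111, hu112]
      linear_combination -r * q * (h0 + h3) - r ^ 2 / 4 * (h4 + h19) - r ^ 2 / 8 * (h5 + h6 + h31
        + h32) - 2 * q ^ 2 * (h17 + h18 + h26 + h27) - r * q / 2 * (h20 + h21 + h22 + h23 + h24 +
        h25 + h28 + h29) - hrq
    linear_combination h + (u002 * u112 - u012 * u012) * hs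
  · have h : u000 * u012 - u001 * u002 + (u001 * u112 - u011 * u012) + 2 * (u002 * u122 - u012 *
    u022) = 0 := by
      rw [hu000, hu001, hu002, hu011, hu012, hu022, hu112, hu122]
      linear_combination -q ^ 2 * (h17 - h18 - h26 + h27) + r * q / 4 * (h20 - h21 - h22 + h23 -
        h24 + h25 - h28 + h29) - r ^ 2 / 8 * (h31 - h32)
    linear_combination sqrtTwo * h + sqrtTwo * (u002 * u122 - u012 * u022) * hs
  · have h : u001 * u012 - u011 * u002 + (u011 * u112 - u111 * u012) + 2 * (u012 * u122 - u112 *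
    u022) = 0 := by
      rw [hu001, hu002, hu011, hu012, hu022, hu111, hu112, hu122]
      linear_combination r ^ 2 / 8 * (h5 - h6) + q ^ 2 * (h17 - h18 + h26 - h27) + r * q / 4 *
        (h20 - h21 + h22 - h23 + h24 - h25 - h28 + h29)
    linear_combination sqrtTwo * h + sqrtTwo * (u012 * u122 - u112 * u022) * hs
  · have h : u000 * u022 - u002 * u002 + (u001 * u122 - u012 * u012) + 2 * (u002 * u222 - u022 *
    u022) = 0 := by
      rw [hu000, hu001, hu002, hu012, hu022, hu122, hu222]
      linear_combination -r * q / 2 * (h1 + h13) - 2 * q ^ 2 * h7 - r * q / 4 * (h9 + h10 + h30 +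
        h33) - r ^ 2 / 16 * (h11 + h12 + h15 + h16) - q ^ 2 / 2 * (h17 + h18 + h26 + h27) - r * q
        / 8 * (h20 + h21 + h22 + h23 + h24 + h25 + h28 + h29) - r ^ 2 / 8 * (h31 + h32) - hrq / 2
    linear_combination sqrtTwo ^ 2 * h + sqrtTwo ^ 2 * (u002 * u222 - u022 * u022) * hs
  · have h : u001 * u022 - u012 * u002 + (u011 * u122 - u112 * u012) + 2 * (u012 * u222 - u122 *
    u022) = 0 := by
      rw [hu001, hu002, hu011, hu012, hu022, hu112, hu122, hu222]
      linear_combination -r * q / 4 * (h9 - h10 + h30 - h33) - r ^ 2 / 16 * (h11 - h12 + h15 -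
        h16) + q ^ 2 / 2 * (h17 + h18 - h26 - h27) - r * q / 8 * (h20 + h21 - h22 - h23 - h24 -
        h25 + h28 + h29)
    linear_combination sqrtTwo ^ 2 * h + sqrtTwo ^ 2 * (u012 * u222 - u122 * u022) * hs
  · have h : u011 * u022 - u012 * u012 + (u111 * u122 - u112 * u112) + 2 * (u112 * u222 - u122 *
    u122) = 0 := by
      rw [hu011, hu012, hu022, hu111, hu112, hu122, hu222]
      linear_combination -r * q / 2 * (h2 + h14) - r ^ 2 / 8 * (h5 + h6) - 2 * q ^ 2 * h8 - r * q
        / 4 * (h9 + h10 + h30 + h33) - r ^ 2 / 16 * (h11 + h12 + h15 + h16) - q ^ 2 / 2 * (h17 +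
        h18 + h26 + h27) - r * q / 8 * (h20 + h21 + h22 + h23 + h24 + h25 + h28 + h29) - hrq / 2
    linear_combination sqrtTwo ^ 2 * h + sqrtTwo ^ 2 * (u112 * u222 - u122 * u122) * hs

/-! ### Asymptotic directions and conclusion for the three configurations -/

/-- In (8,4,2,1) each entry exceeds the sum of the later ones, so the first non-zero coordinate of a
vector, always positive here, decides the sign of the product. -/
lemma F4Plus_exists_pos (r q : ℂ) (k : Fin 24) :
    ∃ s : ℝ, 0 < s ∧ (F4Plus r q k).1 ⬝ᵥ ![8, 4, 2, 1] = s := by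
  have h : ∀ w : ℂ, (0 < w.re ∧ w = (w.re : ℂ)) → ∃ s : ℝ, 0 < s ∧ w = s := fun w hw =>
    ⟨w.re, hw⟩
  apply h
  fin_cases k <;> simp [F4Plus, Matrix.dotProduct_cons] <;> norm_num

set_option maxHeartbeats 2000000 in
theorem F4Plus_satisfiesWDVV {r q : ℂ} (hq : q ≠ 0) (hr : r = -2 * q ∨ r = -4 * q) :
    PrepotentialSatisfiesWDVV (F4Plus r q) := by
  have hrq : r ^ 2 + 6 * (r * q) + 8 * q ^ 2 = 0 := by
    rcases hr with rfl | rfl <;> ring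
  have hcomm : ∀ x ∈ regularLocus (F4Plus r q), ∀ i j,
      Commute (cotMatrix (F4Plus r q) i x) (cotMatrix (F4Plus r q) j x) := fun x hx i j =>
    F4Plus_commute hrq (satisfiesCotAddition_cot hx) i j
  rcases hr with rfl | rfl
  -- For r = -2q, the sum of c_α α₁ α⊗α is diag(2q,0,0,0) and that of c_α α₂ α⊗α is
  -- diag(0,2q,2q,2q); together they give 2q times the identity.
  · refine prepotentialSatisfiesWDVV_of_commute _ hcomm _ (F4Plus_exists_pos _ _) ![1, 1, 0, 0]
      (2 * q) (by simpa using hq) fun i j => ?_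
    fin_cases i <;> fin_cases j <;> simp [F4Plus, Fin.sum_univ_succ] <;> ring
  -- In general the sum of c_α α₁ α⊗α is diag(2r+6q, r+2q, r+2q, r+2q), which is already scalar for
  -- r = -4q.
  · refine prepotentialSatisfiesWDVV_of_commute _ hcomm _ (F4Plus_exists_pos _ _) ![1, 0, 0, 0]
      (-2 * q) (by simpa using hq) fun i j => ?_
    fin_cases i <;> fin_cases j <;> simp [F4Plus, Fin.sum_univ_succ] <;> ring

lemma F4A1One_exists_pos (r q : ℂ) (k : Fin 13) :
    ∃ s : ℝ, 0 < s ∧ (F4A1One r q k).1 ⬝ᵥ ![4, 2, 1] = s := by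
  have h : ∀ w : ℂ, (0 < w.re ∧ w = (w.re : ℂ)) → ∃ s : ℝ, 0 < s ∧ w = s := fun w hw =>
    ⟨w.re, hw⟩
  apply h
  fin_cases k <;> simp [F4A1One, Matrix.dotProduct_cons] <;> norm_num

set_option maxHeartbeats 2000000 in
theorem F4A1One_satisfiesWDVV {r q : ℂ} (hq : q ≠ 0) (hr : r = -2 * q ∨ r = -4 * q) :
    PrepotentialSatisfiesWDVV (F4A1One r q) := by
  have hrq : r ^ 2 + 6 * (r * q) + 8 * q ^ 2 = 0 := by
    rcases hr with rfl | rfl <;> ring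
  have hcomm : ∀ x ∈ regularLocus (F4A1One r q), ∀ i j,
      Commute (cotMatrix (F4A1One r q) i x) (cotMatrix (F4A1One r q) j x) := fun x hx i j =>
    F4A1One_commute hrq (satisfiesCotAddition_cot hx) i j
  rcases hr with rfl | rfl
  -- The vectors e₁ and e₂ lie in the hyperplane of projection, so the same a and κ as for F₄⁺ work:
  -- the quadratic form is restricted to the hyperplane.
  · refine prepotentialSatisfiesWDVV_of_commute _ hcomm _ (F4A1One_exists_pos _ _) ![1, 1, 0]
      (2 * q) (by simpa using hq) fun i j => ?_
    fin_cases i <;> fin_cases j <;> simp [F4A1One, Fin.sum_univ_succ] <;> ring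
  · refine prepotentialSatisfiesWDVV_of_commute _ hcomm _ (F4A1One_exists_pos _ _) ![1, 0, 0]
      (-2 * q) (by simpa using hq) fun i j => ?_
    fin_cases i <;> fin_cases j <;> simp [F4A1One, Fin.sum_univ_succ] <;> ring

/-- The last entry √2 makes every product with a vector of the configuration rational. -/
lemma F4A1Two_exists_pos (r q : ℂ) (k : Fin 16) :
    ∃ s : ℝ, 0 < s ∧ (F4A1Two r q k).1 ⬝ᵥ ![8, 2, sqrtTwo] = s := by
  have h : ∀ w : ℂ, (0 < w.re ∧ w = (w.re : ℂ)) → ∃ s : ℝ, 0 < s ∧ w = s := fun w hw =>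
    ⟨w.re, hw⟩
  apply h
  have hs : sqrtTwo * sqrtTwo = 2 := by rw [← sq, sqrtTwo_sq]
  fin_cases k <;>
    simp [F4A1Two, Matrix.dotProduct_cons, hs, div_mul_eq_mul_div, neg_div] <;> norm_num

set_option maxHeartbeats 2000000 in
theorem F4A1Two_satisfiesWDVV {r q : ℂ} (hq : q ≠ 0) (hr : r = -2 * q ∨ r = -4 * q) :
    PrepotentialSatisfiesWDVV (F4A1Two r q) := by
  have hrq : r ^ 2 + 6 * (r * q) + 8 * q ^ 2 = 0 := by
    rcases hr with rfl | rfl <;> ring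
  have hcomm : ∀ x ∈ regularLocus (F4A1Two r q), ∀ i j,
      Commute (cotMatrix (F4A1Two r q) i x) (cotMatrix (F4A1Two r q) j x) := fun x hx i j =>
    F4A1Two_commute hrq (satisfiesCotAddition_cot hx) i j
  rcases hr with rfl | rfl
  · refine prepotentialSatisfiesWDVV_of_commute _ hcomm _ (F4A1Two_exists_pos _ _) ![1, 1, 0]
      (2 * q) (by simpa using hq) fun i j => ?_
    have hs := sqrtTwo_sq
    -- Odd powers of √2 cancel by themselves; the goal left for the last step is the third diagonal
    -- entry, which contains √2².
    fin_cases i <;> fin_cases j <;> simp [F4A1Two, Fin.sum_univ_succ] <;> ring_nf; simp [hs]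
  · refine prepotentialSatisfiesWDVV_of_commute _ hcomm _ (F4A1Two_exists_pos _ _) ![1, 0, 0]
      (-2 * q) (by simpa using hq) fun i j => ?_
    have hs := sqrtTwo_sq
    fin_cases i <;> fin_cases j <;> simp [F4A1Two, Fin.sum_univ_succ] <;> ring_nf; simp [hs]

theorem mainTheorem8 (r q : ℂ) (hq : q ≠ 0) (hr : r = -2 * q ∨ r = -4 * q) :
    PrepotentialSatisfiesWDVV (F4Plus r q) ∧
      PrepotentialSatisfiesWDVV (F4A1One r q) ∧
      PrepotentialSatisfiesWDVV (F4A1Two r q) := 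
  ⟨F4Plus_satisfiesWDVV hq hr, F4A1One_satisfiesWDVV hq hr, F4A1Two_satisfiesWDVV hq hr⟩
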